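/- Let the integers $v_0(n)$, $n\ge 0$, be defined by the generating function $$\sum_{n=0}^\infty v_0(n)\,q^n=\sum_{k=0}^\infty \frac{q^{k^2}\,(-q;q^2)_k}{(q;q^2)_k},\qquad (a;q)_k=\prod_{i=1}^{k}\bigl(1-aq^{i-1}\bigr),\quad (a;q)_0=1,$$ so that $v_0(n)$ is the $n$-th coefficient of $\frac{V_0(q)+1}{2}$, where $V_0(q)$ is the eighth order mock theta function of Gordon and McIntosh. Then for every odd prime $p$ and all integers $n,\alpha,\beta\ge 0$, $$v_0\bigl(2^{2\alpha+2}p^{2\beta+1}(8pn+8i+p)\bigr)\equiv 0 \pmod{2^{3\alpha+9}}\qquad\text{for every } i\in\{1,2,\ldots,p-1\},$$ and $$v_0\bigl(2^{2\alpha+2}p^{2\beta}(8pn+8j+1)\bigr)\equiv 0 \pmod{2^{3\alpha+9}}$$ for every integer $j$ with $0\le j\le p-1$ and Legendre symbol $\left(\frac{8j+1}{p}\right)=-1$. -/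

import Mathlib

open PowerSeries

/-- The finite `q`-shifted factorial `(a; q)_n = ∏_{i = 1}^{n} (1 - a q^{i-1})`. -/
def qPochhammer {R : Type*} [CommRing R] (a q : R) (n : ℕ) : R :=
  ∏ i ∈ Finset.range n, (1 - a * q ^ i)

/-- The formal power series `q^{k^2} (-q; q^2)_k / (q; q^2)_k` with integer coefficients.
The denominator has constant coefficient `1`, and `PowerSeries.invOfUnit _ 1` is its inverse. -/
noncomputable def v0Term (k : ℕ) : ℤ⟦X⟧ :=
  X ^ (k ^ 2) * qPochhammer (-X) (X ^ 2) k *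
    PowerSeries.invOfUnit (qPochhammer X (X ^ 2) k) 1

/-- The division in `v0Term` is a genuine one. -/
theorem v0Term_mul_denom (k : ℕ) :
    v0Term k * qPochhammer X (X ^ 2) k = X ^ (k ^ 2) * qPochhammer (-X) (X ^ 2) k := by
  have h : constantCoeff (qPochhammer (X : ℤ⟦X⟧) (X ^ 2) k) = ((1 : ℤˣ) : ℤ) := by
    simp [qPochhammer, map_prod]
  rw [v0Term, mul_assoc, PowerSeries.invOfUnit_mul _ _ h, mul_one]

/-- The `k`-th term starts at `q^{k^2}`, so only the terms with `k ≤ n` contribute to the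
coefficient of `q^n`. -/
theorem coeff_v0Term_of_lt {n k : ℕ} (h : n < k) : coeff n (v0Term k) = 0 := by
  have h2 : n < k ^ 2 := lt_of_lt_of_le h (Nat.le_self_pow two_ne_zero k)
  rw [v0Term, mul_assoc, PowerSeries.coeff_X_pow_mul']
  exact if_neg (not_le.mpr h2)

/-- `v_0(n)`, the coefficient of `q^n` in `∑_{k ≥ 0} q^{k^2} (-q; q^2)_k / (q; q^2)_k`.
The terms with `k > n` do not contribute (`coeff_v0Term_of_lt`). -/
noncomputable def v0 (n : ℕ) : ℤ :=
  ∑ k ∈ Finset.range (n + 1), coeff n (v0Term k)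

open scoped PowerSeries.WithPiTopology in
/-- The generating function: `∑_{n ≥ 0} v_0(n) q^n = ∑_{k ≥ 0} q^{k^2} (-q; q^2)_k / (q; q^2)_k`
in `ℤ⟦q⟧`, as a convergent sum of formal power series. -/
theorem hasSum_v0Term : HasSum v0Term (PowerSeries.mk v0) := by
  rw [PowerSeries.WithPiTopology.hasSum_iff_hasSum_coeff]
  intro d
  rw [coeff_mk]
  refine hasSum_sum_of_ne_finset_zero fun k hk => ?_
  exact coeff_v0Term_of_lt (by simpa [Nat.lt_succ_iff] using hk)

/-! Write `φ(q) = ∑ q^{n^2}` and let `U` keep the coefficients with index divisible by 4. The goal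
is that `2^{3α+9}` divides `v0 (4^{α+1} N)` for every non-square `N ≡ 1 (mod 8)` (`pow_dvd_v0`).
Both families in the theorem consist of such `N`: in the first the `p`-adic valuation is odd, in the
second the cofactor of `p^{2β}` is a non-residue mod `p`.

The series `F = ∑ (2 v0(4n) - [n = 0]) q^n` equals `φ(q)^2/φ(-q)` (`quartic_section_mul_theta_neg`).
Euler's series `L_n` for `(-y; q^2)_∞` with `y = ±q` turn the even part of the series of `v0` into a
bilateral sum of products `L_n L_{-n}`. Expanding and regrouping that sum gives a theta function
times an infinite product. Squaring removes the product, and a second bisection reaches `F`.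

Put `r = φ(q)/φ(-q) - 1` and `h = 4((1+r)^4 - 1)`, so that `F = φ(1 + r)`. Over `ℤ[h(q^4)]` the
series `r` is a root of a monic quartic (`ratioSub_pow_four`). Hence `U` sends `φ r ℤ[r]` into `M =
φ h ℤ[h]`, and since `h ∈ 4r ℤ[r]` it sends `M` into `8M` (`sect_four_hauptModule`). As `U φ = φ`,
it follows that `U^{α+1} F = φ + 8^α m` with `m ∈ M`.

At a non-square index `N ≡ 1 (mod 8)` the coefficient of `φ` is zero. Splitting by exponents mod 8
shows that there `2^10` divides the coefficient of `F` and `2^13` that of every element of `M`.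
These give the cases `α = 0` and `α ≥ 1`. -/

open scoped PowerSeries.WithPiTopology

/-! ### Square exponents, signs, and convergence of families of power series. -/

/-- The square of an integer, as a natural number. -/
def sqNat (z : ℤ) : ℕ := z.natAbs ^ 2

lemma sqNat_cast (z : ℤ) : ((sqNat z : ℕ) : ℤ) = z ^ 2 := by
  simp [sqNat]

lemma sqNat_neg (z : ℤ) : sqNat (-z) = sqNat z := by
  simp [sqNat]

lemma natAbs_le_of_sqNat_le {z : ℤ} {n : ℕ} (h : sqNat z ≤ n) : z.natAbs ≤ n :=
  (Nat.le_self_pow two_ne_zero _).trans h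

lemma finite_sqNat_le (n : ℕ) : {z : ℤ | sqNat z ≤ n}.Finite := by
  refine (Set.finite_Icc (-(n : ℤ)) n).subset fun z hz => ?_
  have := natAbs_le_of_sqNat_le hz
  simp only [Set.mem_Icc]
  omega

/-- The sign `(-1) ^ z` as a power series. -/
noncomputable def signSeries (z : ℤ) : ℤ⟦X⟧ := ((z.negOnePow : ℤ) : ℤ⟦X⟧)

lemma signSeries_add (m n : ℤ) : signSeries (m + n) = signSeries m * signSeries n := by
  simp [signSeries, Int.negOnePow_add]

lemma signSeries_natCast (n : ℕ) : signSeries n = (-1) ^ n := by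
  simp [signSeries]

lemma signSeries_neg (n : ℤ) : signSeries (-n) = signSeries n := by
  simp [signSeries]

lemma signSeries_mul_self (n : ℤ) : signSeries n * signSeries n = 1 := by
  rw [← signSeries_add]; simp [signSeries, Int.negOnePow_even]

lemma signSeries_even {n : ℤ} (h : Even n) : signSeries n = 1 := by
  simp [signSeries, Int.negOnePow_even n h]

lemma signSeries_odd {n : ℤ} (h : Odd n) : signSeries n = -1 := by
  simp [signSeries, Int.negOnePow_odd n h]

lemma neg_pow_sqNat (y : ℤ⟦X⟧) (z : ℤ) : (-y) ^ sqNat z = signSeries z * y ^ sqNat z := by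
  rcases Int.even_or_odd z with h | h
  · have : Even (sqNat z) := (Int.natAbs_even.2 h).pow_of_ne_zero two_ne_zero
    rw [this.neg_pow, signSeries_even h, one_mul]
  · have : Odd (sqNat z) := (Int.natAbs_odd.2 h).pow
    rw [this.neg_pow, signSeries_odd h, neg_one_mul]

/-- Each coefficient receives only finitely many contributions, so convergence reduces to finiteness
of sets of exponents. -/
lemma summable_of_X_pow_dvd {ι : Type*} {g : ι → ℤ⟦X⟧} (e : ι → ℕ)
    (he : ∀ n, {i | e i ≤ n}.Finite) (h : ∀ i, X ^ e i ∣ g i) : Summable g := by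
  rw [WithPiTopology.summable_iff_summable_coeff]
  intro n
  refine summable_of_hasFiniteSupport ((he n).subset fun i hi => ?_)
  by_contra hlt
  exact hi ((X_pow_dvd_iff.1 (h i)) n (by simpa using hlt))

lemma HasSum.expand {ι : Type*} {g : ι → ℤ⟦X⟧} {a : ℤ⟦X⟧} (p : ℕ) (hp : p ≠ 0) (h : HasSum g a) :
    HasSum (fun i => PowerSeries.expand p hp (g i)) (PowerSeries.expand p hp a) := by
  rw [WithPiTopology.hasSum_iff_hasSum_coeff] at h ⊢
  intro d
  simp only [coeff_expand]
  split_ifs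
  · exact h _
  · exact hasSum_zero

lemma coeff_evalNegHom (f : ℤ⟦X⟧) (n : ℕ) : coeff n (evalNegHom f) = (-1) ^ n * coeff n f := by
  simp [evalNegHom, coeff_rescale]

lemma HasSum.evalNegHom {ι : Type*} {g : ι → ℤ⟦X⟧} {a : ℤ⟦X⟧} (h : HasSum g a) :
    HasSum (fun i => PowerSeries.evalNegHom (g i)) (PowerSeries.evalNegHom a) := by
  rw [WithPiTopology.hasSum_iff_hasSum_coeff] at h ⊢
  intro d
  simp only [coeff_evalNegHom]
  exact (h d).mul_left _

lemma hasSum_of_shift {f : ℕ → ℤ⟦X⟧} {a : ℤ⟦X⟧} (h0 : f 0 = 0)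
    (h : HasSum (fun n => f (n + 1)) a) : HasSum f a := by
  have := (hasSum_nat_add_iff 1).1 h
  simpa [h0] using this

/-- The hypothesis `y ^ 2 = X ^ 2` means `y = ±q`; it lets one argument serve both signs. -/
lemma X_pow_dvd_pow {y : ℤ⟦X⟧} (hy : y ^ 2 = X ^ 2) (n : ℕ) : (X : ℤ⟦X⟧) ^ n ∣ y ^ n := by
  rcases sq_eq_sq_iff_eq_or_eq_neg.1 hy with h | h
  · rw [h]
  · rw [h, neg_pow]; exact dvd_mul_left _ _

/-! ### Euler's series for `(-y; q^2)_∞` and its shifts. -/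

/-- `1 / (q^2; q^2)_j`. -/
noncomputable def invPoch (j : ℕ) : ℤ⟦X⟧ :=
  PowerSeries.invOfUnit (qPochhammer (X ^ 2) (X ^ 2) j) 1

lemma invPoch_mul (j : ℕ) : invPoch j * qPochhammer (X ^ 2) (X ^ 2) j = 1 := by
  have h : constantCoeff (qPochhammer (X ^ 2 : ℤ⟦X⟧) (X ^ 2) j) = ((1 : ℤˣ) : ℤ) := by
    simp [qPochhammer, map_prod]
  rw [invPoch, PowerSeries.invOfUnit_mul _ _ h]

lemma invPoch_zero : invPoch 0 = 1 := by
  simpa [qPochhammer] using invPoch_mul 0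

lemma invPoch_succ (j : ℕ) : invPoch (j + 1) * (1 - X ^ (2 * j + 2)) = invPoch j := by
  have h1 := invPoch_mul (j + 1)
  have h2 := invPoch_mul j
  rw [qPochhammer, Finset.prod_range_succ, ← qPochhammer] at h1
  linear_combination (exp := 1) invPoch j * h1 - invPoch (j + 1) * (1 - X ^ (2 * j + 2)) * h2

/-- `∑_j y^{(n-j)^2} / (q^2; q^2)_j`. -/
noncomputable def eulerSum (y : ℤ⟦X⟧) (n : ℤ) : ℤ⟦X⟧ := ∑' j : ℕ, y ^ sqNat (n - j) * invPoch j

lemma finite_sqNat_sub_le (m : ℤ) (n : ℕ) : {j : ℕ | sqNat (m - j) ≤ n}.Finite := by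
  refine (Set.finite_Iic (m.natAbs + n)).subset fun z hz => ?_
  have := natAbs_le_of_sqNat_le hz
  simp only [Set.mem_Iic]
  omega

lemma hasSum_eulerSum {y : ℤ⟦X⟧} (hy : y ^ 2 = X ^ 2) (n : ℤ) :
    HasSum (fun j : ℕ => y ^ sqNat (n - j) * invPoch j) (eulerSum y n) :=
  (summable_of_X_pow_dvd (fun j : ℕ => sqNat (n - j)) (finite_sqNat_sub_le n)
    fun _ => (X_pow_dvd_pow hy _).mul_right _).hasSum

/-- Since `(1 - q^{2j})/(q^2; q^2)_j = 1/(q^2; q^2)_{j-1}`, inserting `1 - q^{2j}` shifts `j` by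
one, which amounts to replacing `n` by `n - 1`. -/
lemma hasSum_eulerSum_sub {y : ℤ⟦X⟧} (hy : y ^ 2 = X ^ 2) (n : ℤ) :
    HasSum (fun j : ℕ => y ^ sqNat (n - j) * X ^ (2 * j) * invPoch j)
      (eulerSum y n - eulerSum y (n - 1)) := by
  have h : HasSum (fun j : ℕ => y ^ sqNat (n - j) * ((1 - X ^ (2 * j)) * invPoch j))
      (eulerSum y (n - 1)) := by
    refine hasSum_of_shift (by simp) ?_
    refine (hasSum_eulerSum hy (n - 1)).congr_fun fun j => ?_
    rw [← invPoch_succ j, show n - ((j + 1 : ℕ) : ℤ) = n - 1 - j by push_cast; ring]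
    ring
  refine ((hasSum_eulerSum hy n).sub h).congr_fun fun j => ?_
  ring

/-- This rests on `(m + 1 - j)^2 + 2j = (m - j)^2 + 2m + 1`. Iterated, it produces the finite
product `(-y; q^2)_n`. -/
lemma eulerSum_succ {y : ℤ⟦X⟧} (hy : y ^ 2 = X ^ 2) (m : ℕ) :
    eulerSum y (m + 1 : ℕ) = (1 + y ^ (2 * m + 1)) * eulerSum y m := by
  have h := hasSum_eulerSum_sub hy (m + 1 : ℕ)
  have h2 := (hasSum_eulerSum hy m).mul_left (y ^ (2 * m + 1))
  have h3 := h.unique (h2.congr_fun fun j => ?_)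
  · rw [show ((m + 1 : ℕ) : ℤ) - 1 = m by push_cast; ring] at h3
    linear_combination h3
  · rw [← mul_assoc, ← pow_add, pow_mul, ← hy, ← pow_mul, ← pow_add]
    congr 2
    zify
    simp only [sqNat_cast]
    ring

lemma eulerSum_neg_succ {y : ℤ⟦X⟧} (hy : y ^ 2 = X ^ 2) (m : ℕ) :
    (1 + y ^ (2 * m + 1)) * eulerSum y (-(m + 1 : ℕ)) = y ^ (2 * m + 1) * eulerSum y (-m) := by
  have h := (hasSum_eulerSum_sub hy (-m)).mul_left (y ^ (2 * m + 1))
  have h2 := hasSum_eulerSum hy (-(m + 1 : ℕ))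
  have h3 := h.unique (h2.congr_fun fun j => ?_)
  · rw [show (-m : ℤ) - 1 = -(m + 1 : ℕ) by push_cast; ring] at h3
    linear_combination -h3
  · rw [← mul_assoc, ← mul_assoc, ← pow_add, pow_mul X, ← hy, ← pow_mul, ← pow_add]
    congr 2
    zify
    simp only [sqNat_cast]
    ring

lemma qPochhammer_succ (a q : ℤ⟦X⟧) (n : ℕ) :
    qPochhammer a q (n + 1) = qPochhammer a q n * (1 - a * q ^ n) := by
  rw [qPochhammer, Finset.prod_range_succ, ← qPochhammer]

lemma map_qPochhammer (f : ℤ⟦X⟧ →+* ℤ⟦X⟧) (a q : ℤ⟦X⟧) (n : ℕ) :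
    f (qPochhammer a q n) = qPochhammer (f a) (f q) n := by
  simp [qPochhammer, map_prod]

lemma pow_two_mul_add_one {y : ℤ⟦X⟧} (hy : y ^ 2 = X ^ 2) (m : ℕ) :
    y ^ (2 * m + 1) = y * (X ^ 2) ^ m := by
  rw [pow_succ, pow_mul, hy, mul_comm]

lemma eulerSum_natCast {y : ℤ⟦X⟧} (hy : y ^ 2 = X ^ 2) (n : ℕ) :
    eulerSum y n = qPochhammer (-y) (X ^ 2) n * eulerSum y 0 := by
  induction n with
  | zero => simp [qPochhammer]
  | succ m ih =>
    rw [eulerSum_succ hy, ih, qPochhammer_succ, pow_two_mul_add_one hy]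
    ring

lemma eulerSum_neg_natCast {y : ℤ⟦X⟧} (hy : y ^ 2 = X ^ 2) (n : ℕ) :
    eulerSum y (-n) * qPochhammer (-y) (X ^ 2) n = y ^ (n ^ 2) * eulerSum y 0 := by
  induction n with
  | zero => simp [qPochhammer]
  | succ m ih =>
    have h := eulerSum_neg_succ hy m
    rw [qPochhammer_succ, show (m + 1) ^ 2 = (2 * m + 1) + m ^ 2 by ring, pow_add]
    have h2 := pow_two_mul_add_one hy m
    linear_combination qPochhammer (-y) (X ^ 2) m * h + y ^ (2 * m + 1) * ih
      - eulerSum y (-(m + 1 : ℕ)) * qPochhammer (-y) (X ^ 2) m * h2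

lemma qPochhammer_ne_zero {y : ℤ⟦X⟧} (hy : y ^ 2 = X ^ 2) (n : ℕ) :
    qPochhammer y (X ^ 2) n ≠ 0 := by
  have h0 : constantCoeff y = 0 := by
    have := congrArg (constantCoeff (R := ℤ)) hy
    simpa using this
  have h : constantCoeff (qPochhammer y (X ^ 2) n) = 1 := by
    simp [qPochhammer, map_prod, h0]
  intro h1
  simp [h1] at h

/-- `q^{n^2} L^2 = L_n L_{-n}`. -/
lemma eulerSum_mul_eulerSum_neg {y : ℤ⟦X⟧} (hy : y ^ 2 = X ^ 2) (n : ℤ) :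
    eulerSum y n * eulerSum y (-n) = y ^ sqNat n * eulerSum y 0 ^ 2 := by
  have key (k : ℕ) : eulerSum y k * eulerSum y (-k) = y ^ (k ^ 2) * eulerSum y 0 ^ 2 := by
    rw [eulerSum_natCast hy]
    linear_combination eulerSum y 0 * eulerSum_neg_natCast hy k
  obtain ⟨k, rfl | rfl⟩ := n.eq_nat_or_neg
  · rw [key]; simp [sqNat]
  · rw [neg_neg, mul_comm, key]; simp [sqNat]

lemma neg_X_sq : (-X : ℤ⟦X⟧) ^ 2 = X ^ 2 := by ring

/-- `L_n(q)` supplies the numerator `(-q; q^2)_n` and `L_{-n}(-q)` supplies `(-q)^{n^2}/(q; q^2)_n`;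
the outer sign cancels `(-1)^{n^2}`. -/
lemma signSeries_mul_eulerSum_natCast (n : ℕ) :
    signSeries n * eulerSum X n * eulerSum (-X) (-n) =
      v0Term n * (eulerSum X 0 * eulerSum (-X) 0) := by
  refine mul_right_cancel₀ (qPochhammer_ne_zero (y := X) rfl n) ?_
  have h1 := eulerSum_natCast (y := X) rfl n
  have h2 := eulerSum_neg_natCast neg_X_sq n
  have h3 := v0Term_mul_denom n
  have h4 := neg_pow_sqNat X n
  have h5 := signSeries_mul_self n
  simp only [sqNat, Int.natAbs_natCast] at h4
  rw [neg_neg, h4] at h2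
  rw [h1]
  linear_combination signSeries n * qPochhammer (-X) (X ^ 2) n * eulerSum X 0 * h2
    - (eulerSum X 0 * eulerSum (-X) 0) * h3
    + X ^ (n ^ 2) * qPochhammer (-X) (X ^ 2) n * eulerSum X 0 * eulerSum (-X) 0 * h5

lemma signSeries_mul_eulerSum_neg_natCast (n : ℕ) :
    signSeries (-n) * eulerSum X (-n) * eulerSum (-X) (-(-n)) =
      evalNegHom (v0Term n) * (eulerSum X 0 * eulerSum (-X) 0) := by
  refine mul_right_cancel₀ (qPochhammer_ne_zero neg_X_sq n) ?_
  have h1 := eulerSum_natCast neg_X_sq n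
  have h2 := eulerSum_neg_natCast (y := X) rfl n
  have h3 := congrArg evalNegHom (v0Term_mul_denom n)
  have h4 := neg_pow_sqNat X n
  simp only [sqNat, Int.natAbs_natCast] at h4
  simp only [map_mul, map_qPochhammer, map_pow, map_neg, evalNegHom_X, neg_neg, neg_X_sq] at h3
  rw [neg_neg, signSeries_neg, h1, neg_neg]
  linear_combination signSeries n * qPochhammer X (X ^ 2) n * eulerSum (-X) 0 * h2
    - (eulerSum X 0 * eulerSum (-X) 0) * h3
    - eulerSum X 0 * eulerSum (-X) 0 * qPochhammer X (X ^ 2) n * h4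

/-- The bilateral sum over `L_n L_{-n}(-q)` is a multiple of the even part of the series of `v0`. -/
lemma hasSum_bilateral :
    HasSum (fun n : ℤ => signSeries n * eulerSum X n * eulerSum (-X) (-n))
      ((mk v0 + evalNegHom (mk v0) - 1) * (eulerSum X 0 * eulerSum (-X) 0)) := by
  have h1 := hasSum_v0Term.mul_right (eulerSum X 0 * eulerSum (-X) 0)
  have h2 := hasSum_v0Term.evalNegHom.mul_right (eulerSum X 0 * eulerSum (-X) 0)
  have h := HasSum.of_nat_of_neg
    (f := fun n : ℤ => signSeries n * eulerSum X n * eulerSum (-X) (-n))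
    (h1.congr_fun fun n => signSeries_mul_eulerSum_natCast n)
    (h2.congr_fun fun n => signSeries_mul_eulerSum_neg_natCast n)
  -- The two half-sums both contain `n = 0`, which accounts for the `-1`.
  have h0 : signSeries 0 = 1 := signSeries_even (by simp)
  rw [h0, neg_zero] at h
  rw [show (mk v0 + evalNegHom (mk v0) - 1) * (eulerSum X 0 * eulerSum (-X) 0) =
    mk v0 * (eulerSum X 0 * eulerSum (-X) 0) + evalNegHom (mk v0) * (eulerSum X 0 * eulerSum (-X) 0)
      - 1 * eulerSum X 0 * eulerSum (-X) 0 by ring]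
  exact h

/-! ### Regrouping a bilateral sum of products of partial theta series. -/

lemma finite_sqNat_add_le (N n : ℕ) : {r : ℤ | sqNat r + sqNat (r + N) ≤ n}.Finite :=
  (finite_sqNat_le n).subset fun _ h => (Nat.le_add_right _ _).trans h

lemma finite_sqNat_sub_add_le (m : ℕ) :
    {t : ℤ × ℕ × ℕ | sqNat (t.1 - t.2.1) + sqNat (t.1 + t.2.2) ≤ m}.Finite := by
  refine ((Set.finite_Icc (-(3 * m : ℤ)) (3 * m)).prod
    ((Set.finite_Iic (2 * m)).prod (Set.finite_Iic (2 * m)))).subset ?_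
  rintro ⟨n, j, k⟩ h
  have h1 := natAbs_le_of_sqNat_le ((Nat.le_add_right _ _).trans h)
  have h2 := natAbs_le_of_sqNat_le ((Nat.le_add_left _ _).trans h)
  simp only [Set.mem_prod, Set.mem_Icc, Set.mem_Iic]
  dsimp only at h1 h2
  omega

/-- `∑_r w(r) q^{r^2 + (r + N)^2}`. -/
noncomputable def pairTheta (w : ℤ → ℤ⟦X⟧) (N : ℕ) : ℤ⟦X⟧ :=
  ∑' r : ℤ, w r * X ^ (sqNat r + sqNat (r + N))

lemma hasSum_pairTheta (w : ℤ → ℤ⟦X⟧) (N : ℕ) :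
    HasSum (fun r : ℤ => w r * X ^ (sqNat r + sqNat (r + N))) (pairTheta w N) :=
  (summable_of_X_pow_dvd (fun r : ℤ => sqNat r + sqNat (r + N)) (finite_sqNat_add_le N)
    fun _ => dvd_mul_left _ _).hasSum

/-- Summation over all `n` of a product of two partial theta convolutions: the two inner indices
only enter the exponent through their sum after a shift of `n`. -/
lemma hasSum_mul_partialTheta {w : ℤ → ℤ⟦X⟧} (hw : ∀ m n, w (m + n) = w m * w n)
    {c d : ℕ → ℤ⟦X⟧} {P Q : ℤ → ℤ⟦X⟧} {S : ℤ⟦X⟧}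
    (hP : ∀ n, HasSum (fun j : ℕ => X ^ sqNat (n - j) * c j) (P n))
    (hQ : ∀ n, HasSum (fun k : ℕ => X ^ sqNat (n + k) * d k) (Q n))
    (hS : HasSum (fun n => w n * P n * Q n) S) :
    HasSum (fun N : ℕ => (∑ p ∈ Finset.HasAntidiagonal.antidiagonal N, w (p.1 : ℕ) * c p.1 * d p.2) * pairTheta w N) S := by
  set Φ : ℤ × ℕ × ℕ → ℤ⟦X⟧ := fun t =>
    w t.1 * (X ^ sqNat (t.1 - t.2.1) * c t.2.1) * (X ^ sqNat (t.1 + t.2.2) * d t.2.2) with hΦ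
  have hdvd (t) : X ^ (sqNat (t.1 - t.2.1) + sqNat (t.1 + t.2.2)) ∣ Φ t :=
    ⟨w t.1 * c t.2.1 * d t.2.2, by rw [hΦ, pow_add]; ring⟩
  obtain ⟨S', hS'⟩ := summable_of_X_pow_dvd _ finite_sqNat_sub_add_le hdvd
  have hfac (n : ℤ) : Summable fun p : ℕ × ℕ => Φ (n, p) :=
    summable_of_X_pow_dvd _ (fun m => (finite_sqNat_sub_add_le m).preimage
      (f := fun p => (n, p)) fun _ _ _ _ h => (Prod.ext_iff.1 h).2) fun p => hdvd (n, p)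
  have hSS : S' = S := by
    have hfib (n : ℤ) : HasSum (fun p : ℕ × ℕ => Φ (n, p)) (w n * P n * Q n) := by
      have h1 : HasSum (fun j : ℕ => w n * (X ^ sqNat (n - j) * c j)) (w n * P n) :=
        (hP n).mul_left (w n)
      have h2 := h1.mul (hQ n)
      exact h2 (hfac n)
    exact (hS'.prod_fiberwise hfib).unique hS
  subst hSS
  -- Substituting `r = n - j` turns the exponent `(n-j)^2 + (n+k)^2` into `r^2 + (r+j+k)^2`.
  let e : (ℕ × ℕ) × ℤ ≃ ℤ × ℕ × ℕ :=
    { toFun := fun t => (t.2 + t.1.1, t.1)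
      invFun := fun t => (t.2, t.1 - t.2.1)
      left_inv := fun t => by simp
      right_inv := fun t => by simp }
  have h1 : HasSum (fun p : ℕ × ℕ => w (p.1 : ℕ) * c p.1 * d p.2 * pairTheta w (p.1 + p.2)) S' := by
    refine (e.hasSum_iff.2 hS').prod_fiberwise fun p => ?_
    refine ((hasSum_pairTheta w (p.1 + p.2)).mul_left _).congr_fun fun r => ?_
    simp only [Function.comp, hΦ, e, Equiv.coe_fn_mk, hw, add_sub_cancel_right, Nat.cast_add,
      ← add_assoc, pow_add]
    ring
  have h2 := (Finset.HasAntidiagonal.sigmaAntidiagonalEquivProd (A := ℕ)).hasSum_iff.2 h1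
  refine (h2.sigma fun N => hasSum_fintype _).congr_fun fun N => ?_
  rw [Finset.sum_mul, ← Finset.sum_coe_sort]
  refine Finset.sum_congr rfl fun p _ => ?_
  have := Finset.HasAntidiagonal.mem_antidiagonal.1 p.2
  simp [Finset.HasAntidiagonal.sigmaAntidiagonalEquivProd, this]

/-- Ramanujan's theta function `φ(y) = ∑_n y^{n^2}`. -/
noncomputable def theta (y : ℤ⟦X⟧) : ℤ⟦X⟧ := ∑' n : ℤ, y ^ sqNat n

lemma hasSum_theta {y : ℤ⟦X⟧} (hy : y ^ 2 = X ^ 2) :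
    HasSum (fun n : ℤ => y ^ sqNat n) (theta y) :=
  (summable_of_X_pow_dvd sqNat finite_sqNat_le fun _ => X_pow_dvd_pow hy _).hasSum

lemma evalNegHom_theta : evalNegHom (theta X) = theta (-X) := by
  refine (hasSum_theta (y := X) rfl).evalNegHom.unique
    ((hasSum_theta neg_X_sq).congr_fun fun n => ?_)
  simp

lemma hasSum_eulerSum_negX (n : ℤ) :
    HasSum (fun j : ℕ => X ^ sqNat (n - j) * ((-1) ^ j * invPoch j))
      (signSeries n * eulerSum (-X) n) := by
  refine ((hasSum_eulerSum neg_X_sq n).mul_left (signSeries n)).congr_fun fun j => ?_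
  rw [neg_pow_sqNat, sub_eq_add_neg, signSeries_add, signSeries_neg, signSeries_natCast]
  linear_combination -(-1) ^ j * X ^ sqNat (n + -j) * invPoch j * signSeries_mul_self n

lemma sqNat_neg_sub (n : ℤ) (k : ℕ) : sqNat (-n - k) = sqNat (n + k) := by
  rw [← sqNat_neg]; congr 1; ring

/-- `φ(q) (q; q^2)_∞^2 = φ(-q) (-q; q^2)_∞^2`. -/
lemma theta_mul_eulerSum_sq :
    theta X * eulerSum (-X) 0 ^ 2 = theta (-X) * eulerSum X 0 ^ 2 := by
  have hQ (n : ℤ) : HasSum (fun k : ℕ => X ^ sqNat (n + k) * invPoch k) (eulerSum X (-n)) := by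
    simpa only [sqNat_neg_sub] using hasSum_eulerSum (y := X) rfl (-n)
  have h1 : HasSum (fun n : ℤ => signSeries n * eulerSum X n * eulerSum X (-n))
      (theta (-X) * eulerSum X 0 ^ 2) := by
    refine ((hasSum_theta neg_X_sq).mul_right _).congr_fun fun n => ?_
    rw [mul_assoc, eulerSum_mul_eulerSum_neg rfl, neg_pow_sqNat]
    ring
  have h2 : HasSum (fun n : ℤ => signSeries n * (signSeries n * eulerSum (-X) n) *
      (signSeries (-n) * eulerSum (-X) (-n))) (theta X * eulerSum (-X) 0 ^ 2) := by
    refine ((hasSum_theta (y := X) rfl).mul_right _).congr_fun fun n => ?_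
    have h3 := eulerSum_mul_eulerSum_neg neg_X_sq n
    rw [neg_pow_sqNat] at h3
    rw [signSeries_neg]
    linear_combination signSeries n * h3 + (signSeries n * eulerSum (-X) n * eulerSum (-X) (-n)
      + X ^ sqNat n * eulerSum (-X) 0 ^ 2) * signSeries_mul_self n
  have hQ2 (n : ℤ) : HasSum (fun k : ℕ => X ^ sqNat (n + k) * ((-1) ^ k * invPoch k))
      (signSeries (-n) * eulerSum (-X) (-n)) := by
    simpa only [sqNat_neg_sub] using hasSum_eulerSum_negX (-n)
  have h3 := hasSum_mul_partialTheta signSeries_add (fun n => hasSum_eulerSum (y := X) rfl n) hQ h1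
  have h4 := hasSum_mul_partialTheta signSeries_add hasSum_eulerSum_negX hQ2 h2
  refine h4.unique (h3.congr_fun fun N => ?_)
  congr 1
  -- The two expansions differ only in which factor carries the sign, so exchanging `j` and `k`
  -- identifies them.
  rw [← Finset.Nat.sum_antidiagonal_swap]
  refine Finset.sum_congr rfl fun p _ => ?_
  simp only [signSeries_natCast, Prod.fst_swap, Prod.snd_swap]
  have : ((-1) ^ p.2 * (-1) ^ p.2 : ℤ⟦X⟧) = 1 := by rw [← mul_pow]; simp
  linear_combination (-1) ^ p.1 * invPoch p.2 * invPoch p.1 * this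

/-! ### The even part of the generating function. -/

/-- The alternating convolution of `1 / (q^2; q^2)_j` with itself. -/
noncomputable def altConv (N : ℕ) : ℤ⟦X⟧ :=
  ∑ p ∈ Finset.HasAntidiagonal.antidiagonal N, invPoch p.1 * ((-1) ^ p.2 * invPoch p.2)

lemma altConv_def (N : ℕ) : altConv N = ∑ p ∈ Finset.HasAntidiagonal.antidiagonal N,
    invPoch p.1 * ((-1) ^ p.2 * invPoch p.2) := rfl

lemma altConv_eq_coeff (N : ℕ) :
    altConv N = coeff N ((mk invPoch : ℤ⟦X⟧⟦X⟧) * evalNegHom (mk invPoch)) := by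
  simp [altConv, coeff_mul, evalNegHom, coeff_rescale]

/-- In an outer variable `t`, the series `e(t) = ∑ t^j/(q^2; q^2)_j` satisfies `e(q^2 t) = (1 - t)
e(t)`. Therefore `g(t) = e(t) e(-t)` satisfies `g(q^2 t) = (1 - t^2) g(t)`, and the recurrence
compares coefficients of `t^{N+2}`. -/
lemma altConv_add_two (N : ℕ) : altConv (N + 2) * (1 - X ^ (2 * (N + 2))) = altConv N := by
  set e : ℤ⟦X⟧⟦X⟧ := mk invPoch with he
  have h1 : rescale (X ^ 2 : ℤ⟦X⟧) e = (1 - X) * e := by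
    ext1 n
    rw [coeff_rescale, sub_mul, one_mul, map_sub]
    cases n with
    | zero => simp [he]
    | succ n =>
      rw [coeff_succ_X_mul]
      simp only [he, coeff_mk]
      rw [← invPoch_succ n]
      ring
  have h2 : rescale (X ^ 2 : ℤ⟦X⟧) (evalNegHom e) = (1 + X) * evalNegHom e := by
    have := congrArg evalNegHom h1
    rw [map_mul, map_sub, map_one, evalNegHom_X, sub_neg_eq_add] at this
    rw [← this]
    simp [evalNegHom, rescale_rescale, mul_comm]
  have h3 : rescale (X ^ 2 : ℤ⟦X⟧) (e * evalNegHom e) =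
      e * evalNegHom e - X ^ 2 * (e * evalNegHom e) := by
    rw [map_mul, h1, h2]; ring
  have h4 := congrArg (coeff (N + 2)) h3
  rw [coeff_rescale, map_sub, coeff_X_pow_mul, ← altConv_eq_coeff, ← altConv_eq_coeff] at h4
  linear_combination -h4

lemma one_sub_X_pow_ne_zero (n : ℕ) : (1 - X ^ (n + 1) : ℤ⟦X⟧) ≠ 0 := by
  intro h
  have := congrArg constantCoeff h
  simp at this

lemma altConv_two_mul (m : ℕ) : altConv (2 * m) = PowerSeries.expand 2 two_ne_zero (invPoch m) := by
  induction m with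
  | zero => simp [altConv, invPoch_zero]
  | succ m ih =>
    have h := congrArg (PowerSeries.expand 2 two_ne_zero) (invPoch_succ m)
    simp only [map_mul, map_sub, map_one, map_pow, expand_X, ← pow_mul] at h
    have h2 := altConv_add_two (2 * m)
    refine mul_right_cancel₀ (one_sub_X_pow_ne_zero (2 * (2 * m + 1) + 1)) ?_
    rw [show 2 * (2 * m + 1) + 1 + 1 = 2 * (2 * m + 2) by ring, show 2 * (m + 1) = 2 * m + 2 by ring,
      h2, ih, ← h]

lemma altConv_two_mul_add_one (m : ℕ) : altConv (2 * m + 1) = 0 := by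
  induction m with
  | zero => simp [altConv, Finset.Nat.antidiagonal_succ, invPoch_zero]
  | succ m ih =>
    refine mul_right_cancel₀ (one_sub_X_pow_ne_zero (2 * (2 * m + 1 + 1) + 1)) ?_
    have h2 := altConv_add_two (2 * m + 1)
    rw [zero_mul, ← ih, ← h2]
    ring_nf

/-- Completing the square: `r^2 + (r + 2m)^2 = 2(r + m)^2 + 2m^2`. -/
lemma pairTheta_two_mul (m : ℕ) : pairTheta (fun _ => 1) (2 * m) =
    X ^ (2 * m ^ 2) * PowerSeries.expand 2 two_ne_zero (theta X) := by
  have h := ((hasSum_theta (y := X) rfl).expand 2 two_ne_zero).mul_left (X ^ (2 * m ^ 2))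
  have h2 := (Equiv.addRight (m : ℤ)).hasSum_iff.2 h
  refine (hasSum_pairTheta _ _).unique (h2.congr_fun fun r => ?_)
  simp only [Function.comp, Equiv.coe_addRight, map_pow, expand_X, ← pow_mul, ← pow_add, one_mul]
  congr 1
  zify
  simp only [sqNat_cast]
  ring

/-- The even part of the series of `v0`, in terms of theta functions and infinite products. -/
lemma even_part_mul_eulerSum :
    (mk v0 + evalNegHom (mk v0) - 1) * (eulerSum X 0 * eulerSum (-X) 0) =
      PowerSeries.expand 2 two_ne_zero (theta X * eulerSum X 0) := by
  have h : HasSum (fun n : ℤ => (fun _ => 1 : ℤ → ℤ⟦X⟧) n * eulerSum X n *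
      (signSeries (-n) * eulerSum (-X) (-n)))
      ((mk v0 + evalNegHom (mk v0) - 1) * (eulerSum X 0 * eulerSum (-X) 0)) := by
    refine hasSum_bilateral.congr_fun fun n => ?_
    rw [signSeries_neg]; ring
  have hQ2 (n : ℤ) : HasSum (fun k : ℕ => X ^ sqNat (n + k) * ((-1) ^ k * invPoch k))
      (signSeries (-n) * eulerSum (-X) (-n)) := by
    simpa only [sqNat_neg_sub] using hasSum_eulerSum_negX (-n)
  have h1 := hasSum_mul_partialTheta (w := fun _ => 1) (fun _ _ => (one_mul 1).symm)
    (fun n => hasSum_eulerSum (y := X) rfl n) hQ2 h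
  simp only [one_mul, ← altConv_def] at h1
  have hinj : Function.Injective (fun m : ℕ => 2 * m) := fun a b h => by simpa using h
  -- Only even `N = 2m` survive, and the sum over `m` is Euler's series with `q` replaced by `q^2`.
  have h2 := (hinj.hasSum_iff fun N hN => ?_).2 h1
  · refine h2.unique ?_
    rw [map_mul]
    refine (((hasSum_eulerSum (y := X) rfl 0).expand 2 two_ne_zero).mul_left _).congr_fun fun m => ?_
    simp only [Function.comp, altConv_two_mul, pairTheta_two_mul, map_mul, map_pow, expand_X,
      zero_sub, sqNat_neg]
    simp only [sqNat, Int.natAbs_natCast]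
    ring
  · obtain ⟨m, rfl | rfl⟩ := N.even_or_odd'
    · exact absurd ⟨m, rfl⟩ hN
    · rw [altConv_two_mul_add_one, zero_mul]

lemma X_pow_dvd_of_hasSum {ι : Type*} {g : ι → ℤ⟦X⟧} {a : ℤ⟦X⟧} {m : ℕ} (h : HasSum g a)
    (hg : ∀ i, X ^ m ∣ g i) : X ^ m ∣ a := by
  rw [X_pow_dvd_iff]
  intro d hd
  rw [WithPiTopology.hasSum_iff_hasSum_coeff] at h
  refine (h d).unique (hasSum_zero.congr_fun fun i => ?_)
  exact X_pow_dvd_iff.1 (hg i) d hd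

/-! ### Infinite products and quadratic identities for `φ`. -/

/-- `(-y; q^2)_∞` is approximated by the finite products. -/
lemma X_pow_dvd_eulerSum_sub {y : ℤ⟦X⟧} (hy : y ^ 2 = X ^ 2) (m : ℕ) :
    X ^ m ∣ eulerSum y 0 - qPochhammer (-y) (X ^ 2) m := by
  have hs : Summable fun j : ℕ => y ^ sqNat (0 - j) * (X ^ (2 * m * j) * invPoch j) :=
    summable_of_X_pow_dvd (fun j : ℕ => sqNat (0 - j)) (finite_sqNat_sub_le 0)
      fun _ => (X_pow_dvd_pow hy _).mul_right _
  obtain ⟨A, hA⟩ := hs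
  -- `A` is `L_{-m}` without its factor `y^{m^2}`; every term with `j ≥ 1` contains `q^{2mj}`.
  have h1 : X ^ m ∣ A - 1 := by
    have h2 : HasSum (fun j : ℕ => if j = 0 then (1 : ℤ⟦X⟧) else 0) 1 := hasSum_ite_eq 0 1
    refine X_pow_dvd_of_hasSum (hA.sub h2) fun j => ?_
    rcases j with _ | j
    · simp [sqNat, invPoch_zero]
    · simp only [Nat.add_eq_zero_iff, one_ne_zero, and_false, if_false, sub_zero]
      refine (((pow_dvd_pow X ?_).mul_right _).mul_left _)
      nlinarith
  have h3 : eulerSum y (-m) = y ^ (m ^ 2) * A := by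
    refine (hasSum_eulerSum hy _).unique ((hA.mul_left _).congr_fun fun j => ?_)
    rw [mul_assoc 2, pow_mul X, ← hy, ← pow_mul, ← mul_assoc, ← mul_assoc, ← pow_add, ← pow_add]
    congr 2
    zify
    simp only [sqNat_cast]
    ring
  have hy0 : y ≠ 0 := fun h => X_ne_zero (R := ℤ) (by simpa [h] using hy.symm)
  have h4 : A * qPochhammer (-y) (X ^ 2) m = eulerSum y 0 := by
    refine mul_left_cancel₀ (pow_ne_zero (m ^ 2) hy0) ?_
    rw [← eulerSum_neg_natCast hy, h3, mul_assoc]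
  rw [← h4, show A * qPochhammer (-y) (X ^ 2) m - qPochhammer (-y) (X ^ 2) m =
    (A - 1) * qPochhammer (-y) (X ^ 2) m by ring]
  exact h1.mul_right _

lemma eq_of_forall_X_pow_dvd_sub {f g : ℤ⟦X⟧} (h : ∀ m : ℕ, X ^ m ∣ f - g) : f = g := by
  ext n
  have := X_pow_dvd_iff.1 (h (n + 1)) n (Nat.lt_succ_self n)
  rwa [map_sub, sub_eq_zero] at this

/-- `(-q; q^2)_∞ (q; q^2)_∞ = (q^2; q^4)_∞`. -/
lemma eulerSum_mul_eulerSum_negX :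
    eulerSum X 0 * eulerSum (-X) 0 = PowerSeries.expand 2 two_ne_zero (eulerSum (-X) 0) := by
  refine eq_of_forall_X_pow_dvd_sub fun m => ?_
  obtain ⟨u, hu⟩ := X_pow_dvd_eulerSum_sub (y := X) rfl m
  obtain ⟨v, hv⟩ := X_pow_dvd_eulerSum_sub neg_X_sq m
  have hv2 := congrArg (PowerSeries.expand 2 two_ne_zero) hv
  have hP : qPochhammer (-X) (X ^ 2) m * qPochhammer X (X ^ 2) m =
      PowerSeries.expand 2 two_ne_zero (qPochhammer (X : ℤ⟦X⟧) (X ^ 2) m) := by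
    simp only [qPochhammer, map_prod, ← Finset.prod_mul_distrib, map_sub, map_one, map_mul, map_pow,
      expand_X]
    refine Finset.prod_congr rfl fun i _ => ?_
    ring
  rw [map_sub, map_mul, map_pow, expand_X, neg_neg] at hv2
  rw [neg_neg] at hv
  refine ⟨u * eulerSum (-X) 0 + qPochhammer (-X) (X ^ 2) m * v
    - X ^ m * PowerSeries.expand 2 two_ne_zero v, ?_⟩
  linear_combination eulerSum (-X) 0 * hu + qPochhammer (-X) (X ^ 2) m * hv + hP - hv2

lemma finite_sqNat_add_sqNat_le (n : ℕ) : {p : ℤ × ℤ | sqNat p.1 + sqNat p.2 ≤ n}.Finite :=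
  ((finite_sqNat_le n).prod (finite_sqNat_le n)).subset fun _ h =>
    ⟨(Nat.le_add_right _ _).trans h, (Nat.le_add_left _ _).trans h⟩

lemma hasSum_theta_mul_theta {y z : ℤ⟦X⟧} (hy : y ^ 2 = X ^ 2) (hz : z ^ 2 = X ^ 2) :
    HasSum (fun p : ℤ × ℤ => y ^ sqNat p.1 * z ^ sqNat p.2) (theta y * theta z) := by
  have h := (hasSum_theta hy).mul (hasSum_theta hz)
  refine h (summable_of_X_pow_dvd _ finite_sqNat_add_sqNat_le fun p => ?_)
  rw [pow_add]
  exact mul_dvd_mul (X_pow_dvd_pow hy _) (X_pow_dvd_pow hz _)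

/-- A sum over pairs of integers supported on pairs of equal parity. -/
lemma hasSum_sum_diff {f : ℤ × ℤ → ℤ⟦X⟧} {a : ℤ⟦X⟧} (h : HasSum f a)
    (h0 : ∀ p : ℤ × ℤ, Odd (p.1 + p.2) → f p = 0) :
    HasSum (fun p : ℤ × ℤ => f (p.1 + p.2, p.1 - p.2)) a := by
  have hinj : Function.Injective fun p : ℤ × ℤ => (p.1 + p.2, p.1 - p.2) := by
    rintro ⟨a, b⟩ ⟨c, d⟩ h
    simp only [Prod.mk.injEq] at h ⊢
    omega
  refine (hinj.hasSum_iff fun p hp => ?_).2 h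
  refine h0 p ?_
  by_contra hodd
  rw [Int.not_odd_iff_even] at hodd
  obtain ⟨k, hk⟩ := hodd
  refine hp ⟨(k, p.1 - k), ?_⟩
  ext
  · simp
  · simp only; omega

lemma sqNat_add_add_sqNat_sub (m n : ℤ) :
    sqNat (m + n) + sqNat (m - n) = 2 * (sqNat m + sqNat n) := by
  zify
  simp only [sqNat_cast]
  ring

/-- Pairs of opposite parity cancel between the two squares; the others are `(m + n, m - n)`, where
the squares add up to `2(m^2 + n^2)`. -/
lemma theta_sq_add_theta_neg_sq :
    theta X ^ 2 + theta (-X) ^ 2 = 2 * PowerSeries.expand 2 two_ne_zero (theta X ^ 2) := by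
  have h := (hasSum_theta_mul_theta (y := X) (z := X) rfl rfl).add
    (hasSum_theta_mul_theta neg_X_sq neg_X_sq)
  have h2 := hasSum_sum_diff h fun p hp => by
    rw [neg_pow_sqNat, neg_pow_sqNat]
    have : signSeries p.1 * signSeries p.2 = -1 := by rw [← signSeries_add, signSeries_odd hp]
    linear_combination X ^ sqNat p.1 * X ^ sqNat p.2 * this
  have h3 := ((hasSum_theta_mul_theta (y := X) (z := X) rfl rfl).expand 2 two_ne_zero).mul_left 2
  simp only [sq]
  refine h2.unique (h3.congr_fun fun p => ?_)
  rw [neg_pow_sqNat, neg_pow_sqNat]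
  have h4 : signSeries (p.1 + p.2) * signSeries (p.1 - p.2) = 1 := by
    rw [← signSeries_add, signSeries_even ⟨p.1, by ring⟩]
  have h5 : (X : ℤ⟦X⟧) ^ sqNat (p.1 + p.2) * X ^ sqNat (p.1 - p.2) =
      (X ^ 2) ^ sqNat p.1 * (X ^ 2) ^ sqNat p.2 := by
    rw [← pow_add, sqNat_add_add_sqNat_sub, ← pow_mul, ← pow_mul, ← pow_add, mul_add]
  simp only [map_mul, map_pow, expand_X]
  linear_combination 2 * h5 + X ^ sqNat (p.1 + p.2) * X ^ sqNat (p.1 - p.2) * h4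

lemma constantCoeff_two : constantCoeff (2 : ℤ⟦X⟧) = 2 := map_ofNat _ 2

lemma powerSeries_two_ne_zero : (2 : ℤ⟦X⟧) ≠ 0 := fun h => by
  have := constantCoeff_two
  simp [h] at this

/-- Adding the product in both orders makes the pairs of opposite parity cancel, so the same change
of variables applies; the factor 2 is then removed. -/
lemma theta_mul_theta_neg :
    theta X * theta (-X) = PowerSeries.expand 2 two_ne_zero (theta (-X)) ^ 2 := by
  have h := (hasSum_theta_mul_theta (y := X) rfl neg_X_sq).add
    (hasSum_theta_mul_theta (z := X) neg_X_sq rfl)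
  have h2 := hasSum_sum_diff h fun p hp => by
    rw [neg_pow_sqNat, neg_pow_sqNat]
    have h1 : signSeries p.1 * signSeries p.2 = -1 := by rw [← signSeries_add, signSeries_odd hp]
    linear_combination X ^ sqNat p.1 * X ^ sqNat p.2 *
      (signSeries p.1 * h1 - signSeries p.2 * signSeries_mul_self p.1)
  have h3 := ((hasSum_theta_mul_theta neg_X_sq neg_X_sq).expand 2 two_ne_zero).mul_left 2
  refine mul_left_cancel₀ powerSeries_two_ne_zero ?_
  rw [← map_pow, sq, show 2 * (theta X * theta (-X)) =
    theta X * theta (-X) + theta (-X) * theta X by ring]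
  refine h2.unique (h3.congr_fun fun p => ?_)
  rw [neg_pow_sqNat, neg_pow_sqNat]
  have h4 : signSeries (p.1 - p.2) = signSeries (p.1 + p.2) := by
    rw [sub_eq_add_neg, signSeries_add, signSeries_neg, ← signSeries_add]
  have h5 : (X : ℤ⟦X⟧) ^ sqNat (p.1 + p.2) * X ^ sqNat (p.1 - p.2) =
      (X ^ 2) ^ sqNat p.1 * (X ^ 2) ^ sqNat p.2 := by
    rw [← pow_add, sqNat_add_add_sqNat_sub, ← pow_mul, ← pow_mul, ← pow_add, mul_add]
  have h6 (z : ℤ) : PowerSeries.expand 2 two_ne_zero (signSeries z) = signSeries z := by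
    rcases Int.even_or_odd z with h | h
    · rw [signSeries_even h, map_one]
    · rw [signSeries_odd h, map_neg, map_one]
  simp only [map_mul, map_pow, expand_X, neg_pow_sqNat, h6, h4, signSeries_add]
  linear_combination 2 * signSeries p.1 * signSeries p.2 * h5

/-! ### Coefficients of `φ` and its odd part. -/

lemma coeff_theta (N : ℕ) :
    HasSum (fun n : ℤ => if N = sqNat n then (1 : ℤ) else 0) (coeff N (theta X)) := by
  have h := (WithPiTopology.hasSum_iff_hasSum_coeff ℤ).1 (hasSum_theta (y := X) rfl) N
  simpa only [coeff_X_pow] using h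

lemma coeff_theta_of_not_isSquare {N : ℕ} (h : ¬ IsSquare N) : coeff N (theta X) = 0 := by
  refine (coeff_theta N).unique (hasSum_zero.congr_fun fun n => if_neg fun hn => h ?_)
  exact ⟨n.natAbs, by rw [hn, sqNat, sq]⟩

lemma coeff_theta_zero : coeff 0 (theta X) = 1 := by
  have h := hasSum_ite_eq (0 : ℤ) (1 : ℤ)
  refine (coeff_theta 0).unique (h.congr_fun fun n => ?_)
  congr 1
  simp [sqNat, eq_comm (a := 0)]

lemma coeff_theta_sq {k : ℕ} (hk : k ≠ 0) : coeff (k ^ 2) (theta X) = 2 := by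
  have h : HasSum (fun n : ℤ => if k ^ 2 = sqNat n then (1 : ℤ) else 0)
      (∑ n ∈ {(k : ℤ), -(k : ℤ)}, if k ^ 2 = sqNat n then (1 : ℤ) else 0) := by
    refine hasSum_sum_of_ne_finset_zero fun n hn => if_neg fun h => hn ?_
    have : k = n.natAbs := Nat.pow_left_injective two_ne_zero h
    simp only [Finset.mem_insert, Finset.mem_singleton]
    omega
  refine (coeff_theta _).unique ?_
  rw [Finset.sum_pair (by omega)] at h
  simpa [sqNat] using h

/-- The part of `φ` with odd exponents. -/
noncomputable def thetaOdd : ℤ⟦X⟧ := theta X - PowerSeries.expand 4 four_ne_zero (theta X)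

/-- Even squares are 4 times squares, so they make up `φ(q^4)`; odd squares are `1` modulo 8. -/
lemma coeff_thetaOdd (n : ℕ) :
    coeff n thetaOdd = if n % 8 = 1 then coeff n (theta X) else 0 := by
  rw [thetaOdd, map_sub, coeff_expand]
  by_cases h4 : 4 ∣ n
  · obtain ⟨m, rfl⟩ := h4
    rw [if_pos (dvd_mul_right 4 m), if_neg (by omega), Nat.mul_div_cancel_left _ (by norm_num),
      sub_eq_zero]
    by_cases hm : IsSquare m
    · obtain ⟨k, rfl⟩ := hm
      rcases eq_or_ne k 0 with rfl | hk
      · rfl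
      · rw [← sq, coeff_theta_sq hk, show 4 * k ^ 2 = (2 * k) ^ 2 by ring,
          coeff_theta_sq (by positivity)]
    · rw [coeff_theta_of_not_isSquare hm, coeff_theta_of_not_isSquare]
      rintro ⟨k, hk⟩
      have hk2 : 2 ∣ k := by
        have : 2 ∣ k * k := ⟨2 * m, by omega⟩
        rcases Nat.prime_two.dvd_mul.1 this with h | h <;> exact h
      obtain ⟨l, rfl⟩ := hk2
      exact hm ⟨l, by nlinarith⟩
  · rw [if_neg h4, sub_zero]
    split_ifs with h8
    · rfl
    · refine coeff_theta_of_not_isSquare ?_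
      rintro ⟨k, rfl⟩
      obtain ⟨l, rfl | rfl⟩ := k.even_or_odd'
      · exact h4 ⟨l * l, by ring⟩
      · obtain ⟨u, hu⟩ := Nat.even_mul_succ_self l
        refine h8 ?_
        have : (2 * l + 1) * (2 * l + 1) = 8 * u + 1 := by nlinarith
        omega

lemma theta_eq : theta X = PowerSeries.expand 4 four_ne_zero (theta X) + thetaOdd := by
  rw [thetaOdd]; ring

lemma theta_neg_eq : theta (-X) = PowerSeries.expand 4 four_ne_zero (theta X) - thetaOdd := by
  ext n
  rw [← evalNegHom_theta, coeff_evalNegHom]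
  conv_lhs => rw [theta_eq]
  rw [map_add, map_sub, coeff_expand, coeff_thetaOdd]
  rcases n.even_or_odd with h | h
  · have h8 : ¬ n % 8 = 1 := by rcases h with ⟨k, rfl⟩; omega
    rw [h.neg_one_pow, if_neg h8]
    ring
  · have h4 : ¬ 4 ∣ n := by rcases h with ⟨k, rfl⟩; omega
    rw [h.neg_one_pow, if_neg h4]
    ring

lemma two_dvd_coeff_theta {n : ℕ} (hn : n ≠ 0) : (2 : ℤ) ∣ coeff n (theta X) := by
  by_cases h : IsSquare n
  · obtain ⟨k, rfl⟩ := h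
    rw [← sq, coeff_theta_sq (by rintro rfl; simp at hn)]
  · rw [coeff_theta_of_not_isSquare h]; exact dvd_zero _

/-! ### Supports in residue classes, and sections. -/

/-- The exponents of `f` lie in the residue class of `r` modulo `m`. -/
def SupportedMod (m r : ℕ) (f : ℤ⟦X⟧) : Prop := ∀ n, coeff n f ≠ 0 → n ≡ r [MOD m]

namespace SupportedMod

variable {m r s : ℕ} {f g : ℤ⟦X⟧}

lemma coeff_eq_zero (h : SupportedMod m r f) {n : ℕ} (hn : ¬ n ≡ r [MOD m]) : coeff n f = 0 := by
  by_contra h0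
  exact hn (h n h0)

lemma mul (hf : SupportedMod m r f) (hg : SupportedMod m s g) : SupportedMod m (r + s) (f * g) := by
  intro n hn
  rw [coeff_mul] at hn
  obtain ⟨p, hp, h0⟩ := Finset.exists_ne_zero_of_sum_ne_zero hn
  rw [← Finset.HasAntidiagonal.mem_antidiagonal.1 hp]
  exact (hf _ (left_ne_zero_of_mul h0)).add (hg _ (right_ne_zero_of_mul h0))

lemma add (hf : SupportedMod m r f) (hg : SupportedMod m r g) : SupportedMod m r (f + g) := by
  intro n hn
  rw [map_add] at hn
  by_cases h : coeff n f = 0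
  · exact hg n (by rwa [h, zero_add] at hn)
  · exact hf n h

lemma one : SupportedMod m 0 1 := by
  intro n hn
  rw [coeff_one] at hn
  have : n = 0 := by by_contra h; simp [h] at hn
  rw [this]

lemma intCast (z : ℤ) : SupportedMod m 0 (z : ℤ⟦X⟧) := by
  intro n hn
  have h : coeff n ((C z : ℤ⟦X⟧)) ≠ 0 := by simpa using hn
  rw [coeff_C] at h
  have : n = 0 := by by_contra h1; simp [h1] at h
  rw [this]

lemma pow (hf : SupportedMod m r f) (k : ℕ) : SupportedMod m (k * r) (f ^ k) := by
  induction k with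
  | zero => simpa using one
  | succ k ih => rw [pow_succ, add_one_mul]; exact ih.mul hf

lemma congr (hf : SupportedMod m r f) (h : r ≡ s [MOD m]) : SupportedMod m s f :=
  fun n hn => (hf n hn).trans h

lemma expand (p : ℕ) (hp : p ≠ 0) (hf : SupportedMod m r f) :
    SupportedMod (p * m) (p * r) (PowerSeries.expand p hp f) := by
  intro n hn
  rw [coeff_expand] at hn
  split_ifs at hn with h
  · obtain ⟨k, rfl⟩ := h
    rw [Nat.mul_div_cancel_left _ (Nat.pos_of_ne_zero hp)] at hn
    exact (hf k hn).mul_left' p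
  · exact absurd rfl hn

lemma expand_zero (p : ℕ) (hp : p ≠ 0) (f : ℤ⟦X⟧) :
    SupportedMod p 0 (PowerSeries.expand p hp f) := by
  have := expand p hp (m := 1) (r := 0) (f := f) fun n _ => Nat.modEq_one
  simpa using this

lemma of_dvd {k : ℕ} (hf : SupportedMod m r f) (h : k ∣ m) : SupportedMod k r f :=
  fun n hn => (hf n hn).of_dvd h

end SupportedMod

/-- Extraction of the coefficients whose index is a multiple of `m`. -/
noncomputable def sect (m : ℕ) : ℤ⟦X⟧ →+ ℤ⟦X⟧ where
  toFun f := mk fun n => coeff (m * n) f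
  map_add' f g := by ext n; simp
  map_zero' := by ext n; simp

lemma coeff_sect (m n : ℕ) (f : ℤ⟦X⟧) : coeff n (sect m f) = coeff (m * n) f := by
  simp [sect]

lemma sect_expand_mul (m : ℕ) (hm : m ≠ 0) (f g : ℤ⟦X⟧) :
    sect m (PowerSeries.expand m hm g * f) = g * sect m f := by
  ext n
  rw [coeff_sect, coeff_mul, coeff_mul]
  symm
  refine Finset.sum_of_injOn (fun p => (m * p.1, m * p.2)) ?_ ?_ ?_ ?_
  · rintro ⟨a, b⟩ _ ⟨c, d⟩ _ h
    simpa [hm] using h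
  · rintro ⟨a, b⟩ h
    simp only [Finset.mem_coe, Finset.HasAntidiagonal.mem_antidiagonal] at h ⊢
    rw [← h, mul_add]
  · rintro ⟨a, b⟩ h h2
    rw [Finset.HasAntidiagonal.mem_antidiagonal] at h
    rw [coeff_expand]
    split_ifs with hd
    · exfalso
      obtain ⟨c, rfl⟩ := hd
      obtain ⟨d, rfl⟩ := (Nat.dvd_add_right (dvd_mul_right m c)).1 (h ▸ dvd_mul_right m n)
      refine h2 ⟨(c, d), ?_, rfl⟩
      simp only [Finset.mem_coe, Finset.HasAntidiagonal.mem_antidiagonal]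
      simp only [← mul_add] at h
      exact Nat.eq_of_mul_eq_mul_left (Nat.pos_of_ne_zero hm) h
    · exact zero_mul _
  · rintro ⟨a, b⟩ _
    rw [coeff_expand_mul, coeff_sect]

lemma sect_expand (m : ℕ) (hm : m ≠ 0) (g : ℤ⟦X⟧) : sect m (PowerSeries.expand m hm g) = g := by
  ext n; rw [coeff_sect, coeff_expand_mul]

lemma sect_eq_zero {m r : ℕ} {f : ℤ⟦X⟧} (h : SupportedMod m r f) (hr : ¬ m ∣ r) :
    sect m f = 0 := by
  ext n
  rw [coeff_sect, map_zero]
  refine h.coeff_eq_zero fun h2 => hr ?_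
  exact (Nat.modEq_zero_iff_dvd.1 ((Nat.modEq_zero_iff_dvd.2 (dvd_mul_right m n)).symm.trans h2).symm)

/-! ### The quartic section as a theta quotient. -/

lemma v0_zero : v0 0 = 1 := by
  have h := v0Term_mul_denom 0
  simp only [qPochhammer, Finset.range_zero, Finset.prod_empty, mul_one] at h
  simp [v0, h]

/-- The generating function of `2 v0(4n) - [n = 0]` is `φ(q)^2 / φ(-q)`. -/
theorem quartic_section_mul_theta_neg :
    (2 * mk (fun n => v0 (4 * n)) - 1) * theta (-X) = theta X ^ 2 := by
  set E : ℤ⟦X⟧ := 2 * mk (fun n => v0 (2 * n)) - 1 with hE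
  have hE2 : mk v0 + evalNegHom (mk v0) - 1 = PowerSeries.expand 2 two_ne_zero E := by
    rw [hE, map_sub, map_mul, map_one, map_ofNat]
    congr 1
    ext n
    rw [map_add, coeff_evalNegHom, two_mul, map_add, coeff_expand, coeff_mk]
    split_ifs with h
    · obtain ⟨k, rfl⟩ := h
      simp
    · rw [(Nat.not_even_iff_odd.1 (by rwa [even_iff_two_dvd])).neg_one_pow]; ring
  have h1 := even_part_mul_eulerSum
  rw [hE2, eulerSum_mul_eulerSum_negX, ← map_mul] at h1
  replace h1 : E * eulerSum (-X) 0 = theta X * eulerSum X 0 := by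
    have := congrArg (sect 2) h1
    simpa only [sect_expand] using this
  have hL : eulerSum X 0 ≠ 0 := by
    obtain ⟨u, hu⟩ := X_pow_dvd_eulerSum_sub (y := X) rfl 1
    intro h0
    have := congrArg constantCoeff hu
    simp [h0, qPochhammer] at this
  -- Squaring `h1` allows `theta_mul_eulerSum_sq` to replace the ratio of infinite products by a
  -- ratio of theta functions.
  have h2 : E ^ 2 * theta (-X) = theta X ^ 3 := by
    refine mul_right_cancel₀ (pow_ne_zero 2 hL) ?_
    have h3 := theta_mul_eulerSum_sq
    linear_combination -E ^ 2 * h3 + theta X * (E * eulerSum (-X) 0 + theta X * eulerSum X 0) * h1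
  have h4 : (E * PowerSeries.expand 2 two_ne_zero (theta (-X))) ^ 2 = (theta X ^ 2) ^ 2 := by
    linear_combination theta X * h2 - E ^ 2 * theta_mul_theta_neg
  have h5 : E * PowerSeries.expand 2 two_ne_zero (theta (-X)) = theta X ^ 2 := by
    -- The constant terms, all equal to 1, decide the sign of the square root.
    rcases sq_eq_sq_iff_eq_or_eq_neg.1 h4 with h | h
    · exact h
    · exfalso
      have := congrArg constantCoeff h
      have h0 : constantCoeff (theta X) = 1 := by
        rw [← coeff_zero_eq_constantCoeff_apply, coeff_theta_zero]
      have h0' : constantCoeff (theta (-X)) = 1 := by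
        rw [← evalNegHom_theta, ← coeff_zero_eq_constantCoeff_apply, coeff_evalNegHom,
          coeff_theta_zero]
        simp
      have h0E : constantCoeff E = 1 := by
        have h00 : constantCoeff (mk fun n => v0 (2 * n)) = 1 := by
          rw [← coeff_zero_eq_constantCoeff_apply, coeff_mk, mul_zero, v0_zero]
        rw [hE, map_sub, map_mul, h00, constantCoeff_two]
        simp
      simp [h0, h0', h0E] at this
  have h6 : sect 2 (theta X ^ 2) = theta X ^ 2 := by
    have h7 := congrArg (sect 2) theta_sq_add_theta_neg_sq
    have h8 : sect 2 (theta (-X) ^ 2) = sect 2 (theta X ^ 2) := by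
      ext n
      rw [coeff_sect, coeff_sect, ← evalNegHom_theta, ← map_pow, coeff_evalNegHom]
      simp
    rw [map_add, h8, two_mul, map_add, sect_expand, ← two_mul, ← two_mul] at h7
    exact mul_left_cancel₀ powerSeries_two_ne_zero h7
  have h9 := congrArg (sect 2) h5
  rw [mul_comm, sect_expand_mul, h6] at h9
  rw [← h9, mul_comm]
  congr 1
  ext n
  rw [coeff_sect, hE]
  simp only [two_mul, map_sub, map_add, coeff_mk, coeff_one]
  congr 1
  · ring_nf
  · simp

/-! ### The modular equation of degree four. -/

/-- Substitution of `q^4`. -/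
noncomputable abbrev expandFour : ℤ⟦X⟧ →ₐ[ℤ] ℤ⟦X⟧ := PowerSeries.expand 4 four_ne_zero

/-- `1 / φ(-q)`. -/
noncomputable def thetaNegInv : ℤ⟦X⟧ := PowerSeries.invOfUnit (theta (-X)) 1

lemma theta_neg_mul_inv : theta (-X) * thetaNegInv = 1 := by
  refine PowerSeries.mul_invOfUnit _ _ ?_
  rw [← evalNegHom_theta, ← coeff_zero_eq_constantCoeff_apply, coeff_evalNegHom, coeff_theta_zero]
  simp

/-- `φ(q)/φ(-q) - 1`. -/
noncomputable def ratioSub : ℤ⟦X⟧ := 2 * thetaOdd * thetaNegInv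

/-- `4 ((φ(q)/φ(-q))^4 - 1)`. -/
noncomputable def haupt : ℤ⟦X⟧ := 4 * ((1 + ratioSub) ^ 4 - 1)

lemma expandFour_eq (f : ℤ⟦X⟧) : expandFour f =
    PowerSeries.expand 2 two_ne_zero (PowerSeries.expand 2 two_ne_zero f) :=
  PowerSeries.expand_mul 2 two_ne_zero 2 two_ne_zero f

/-- With `a = φ(q^4)` and `b` the odd part of `φ`, `a^2 + b^2 = φ(q^2)^2` and `a^2 - b^2 = φ(q)φ(-q)
= φ(-q^2)^2`. Multiplying and using `theta_mul_theta_neg` at `q^2` gives `φ(-q^4)^4`. -/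
lemma expandFour_theta_pow_sub :
    expandFour (theta X) ^ 4 - thetaOdd ^ 4 = expandFour (theta (-X) ^ 4) := by
  have h1 := theta_mul_theta_neg
  have h2 := theta_sq_add_theta_neg_sq
  have h3 : theta X ^ 2 + theta (-X) ^ 2 = 2 * (expandFour (theta X) ^ 2 + thetaOdd ^ 2) := by
    rw [theta_neg_eq]
    linear_combination (theta X + expandFour (theta X) + thetaOdd) * theta_eq
  have h4 : theta X * theta (-X) = expandFour (theta X) ^ 2 - thetaOdd ^ 2 := by
    rw [theta_neg_eq]
    linear_combination (expandFour (theta X) - thetaOdd) * theta_eq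
  rw [h3] at h2
  have h5 := mul_left_cancel₀ powerSeries_two_ne_zero h2
  have h6 : PowerSeries.expand 2 two_ne_zero (theta X ^ 2) * PowerSeries.expand 2 two_ne_zero
      (theta (-X)) ^ 2 = expandFour (theta (-X) ^ 4) := by
    rw [← map_pow, ← map_mul, ← mul_pow, h1, expandFour_eq, ← map_pow, ← map_pow, ← pow_mul]
  rw [← h6, ← h5, ← h1, h4]
  ring

/-- `φ(q)^4 - φ(-q)^4`. -/
noncomputable def quarticDiff : ℤ⟦X⟧ := theta X ^ 4 - theta (-X) ^ 4

lemma thetaOdd_pow_four : thetaOdd ^ 4 = expandFour quarticDiff := by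
  rw [quarticDiff, map_sub, ← expandFour_theta_pow_sub, map_pow]
  ring

lemma one_add_ratioSub : 1 + ratioSub = theta X * thetaNegInv := by
  have h := theta_neg_mul_inv
  have h2 := theta_neg_eq
  have h3 := theta_eq
  rw [ratioSub]
  linear_combination -h + thetaNegInv * h2 - thetaNegInv * h3

lemma haupt_mul : haupt * theta (-X) ^ 4 = 4 * quarticDiff := by
  rw [haupt, one_add_ratioSub, quarticDiff]
  have h : (theta (-X) * thetaNegInv) ^ 4 = 1 := by rw [theta_neg_mul_inv, one_pow]
  linear_combination 4 * theta X ^ 4 * h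

lemma expandFour_haupt_mul :
    expandFour haupt * (expandFour (theta X) ^ 4 - thetaOdd ^ 4) = 4 * thetaOdd ^ 4 := by
  rw [expandFour_theta_pow_sub, ← map_mul, haupt_mul, map_mul, ← thetaOdd_pow_four, map_ofNat]

lemma theta_neg_ne_zero : theta (-X) ≠ 0 := left_ne_zero_of_mul_eq_one theta_neg_mul_inv

lemma expandFour_theta_pow_sub_ne_zero :
    expandFour (theta X) ^ 4 - thetaOdd ^ 4 ≠ 0 := by
  rw [expandFour_theta_pow_sub]
  refine left_ne_zero_of_mul_eq_one (b := expandFour (thetaNegInv ^ 4)) ?_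
  rw [← map_mul, ← mul_pow, theta_neg_mul_inv, one_pow, map_one]

lemma sub_thetaOdd_mul_inv : (expandFour (theta X) - thetaOdd) * thetaNegInv = 1 := by
  rw [← theta_neg_eq, theta_neg_mul_inv]

/-- The quartic modular equation. -/
lemma ratioSub_pow_four : ratioSub ^ 4 = expandFour haupt *
    (2 * ratioSub ^ 3 + 6 * ratioSub ^ 2 + 8 * ratioSub + 4) := by
  -- From `r = 2b/(a - b)` one has `a/b = (r + 2)/r`, while `h(q^4) = 4b^4/(a^4 - b^4)`. Hence `((r
  -- + 2)^4 - r^4)/r^4 = 4/h(q^4)`, which is the quartic.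
  refine mul_right_cancel₀ expandFour_theta_pow_sub_ne_zero ?_
  have h1 := expandFour_haupt_mul
  have h2 := sub_thetaOdd_mul_inv
  rw [ratioSub]
  set a := expandFour (theta X)
  set b := thetaOdd
  set i := thetaNegInv
  set u := (a - b) * i with hu
  linear_combination -(2 * (2 * b * i) ^ 3 + 6 * (2 * b * i) ^ 2 + 8 * (2 * b * i) + 4) * h1
    + 16 * b ^ 4 * (4 * b ^ 3 * i ^ 3 + 6 * b ^ 2 * i ^ 2 * (u + 1) + 4 * b * i * (u ^ 2 + u + 1)
      + (u ^ 3 + u ^ 2 + u + 1)) * h2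

/-! ### The section operator on `φ r^k`. -/

lemma supportedMod_thetaOdd : SupportedMod 8 1 thetaOdd := by
  intro n hn
  rw [coeff_thetaOdd] at hn
  by_contra h
  exact hn (if_neg h)

lemma sect_four_combination (g₀ g₁ g₂ g₃ : ℤ⟦X⟧) :
    sect 4 (expandFour g₀ + expandFour g₁ * thetaOdd + expandFour g₂ * thetaOdd ^ 2
      + expandFour g₃ * thetaOdd ^ 3) = g₀ := by
  have hb : SupportedMod 4 1 thetaOdd := supportedMod_thetaOdd.of_dvd (by norm_num)
  rw [map_add, map_add, map_add, sect_expand, sect_expand_mul, sect_expand_mul, sect_expand_mul,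
    sect_eq_zero hb (by norm_num), sect_eq_zero (hb.pow 2) (by norm_num),
    sect_eq_zero (hb.pow 3) (by norm_num)]
  ring

/-- Multiplying by a power of `a^4 - b^4 = φ(-q^4)^4` clears denominators. With `b^4` a series in
`q^4`, the result is reduced to degree at most 3 in `b`, and the section is the coefficient of
`b^0`. -/
lemma sect_four_of_mul_eq {f g₀ g₁ g₂ g₃ : ℤ⟦X⟧} {k : ℕ}
    (h : (expandFour (theta X) ^ 4 - thetaOdd ^ 4) ^ k * f =
      expandFour g₀ + expandFour g₁ * thetaOdd + expandFour g₂ * thetaOdd ^ 2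
      + expandFour g₃ * thetaOdd ^ 3) :
    (theta (-X) ^ 4) ^ k * sect 4 f = g₀ := by
  rw [← sect_expand_mul 4 four_ne_zero, ← sect_four_combination g₀ g₁ g₂ g₃, ← h,
    expandFour_theta_pow_sub, ← map_pow]

lemma sect_four_theta : sect 4 (theta X) = theta X := by
  have := sect_four_combination (theta X) 1 0 0
  rw [map_one, map_zero, one_mul, zero_mul, zero_mul, add_zero, add_zero, ← theta_eq] at this
  exact this

lemma pow_mul_theta_mul_ratioSub (k : ℕ) :
    (expandFour (theta X) ^ 4 - thetaOdd ^ 4) ^ k * (theta X * ratioSub ^ k) =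
      (2 * thetaOdd) ^ k * (expandFour (theta X) + thetaOdd) ^ (k + 1) *
        (expandFour (theta X) ^ 2 + thetaOdd ^ 2) ^ k := by
  have h : (expandFour (theta X) ^ 4 - thetaOdd ^ 4) * ratioSub = 2 * thetaOdd *
      ((expandFour (theta X) + thetaOdd) * (expandFour (theta X) ^ 2 + thetaOdd ^ 2)) := by
    rw [ratioSub]
    linear_combination 2 * thetaOdd *
      ((expandFour (theta X) + thetaOdd) * (expandFour (theta X) ^ 2 + thetaOdd ^ 2))
        * sub_thetaOdd_mul_inv
  rw [mul_left_comm, ← mul_pow, h]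
  simp only [mul_pow]
  linear_combination 2 ^ k * thetaOdd ^ k * (expandFour (theta X) + thetaOdd) ^ k *
    (expandFour (theta X) ^ 2 + thetaOdd ^ 2) ^ k * theta_eq

lemma sect_four_theta_mul_ratioSub : sect 4 (theta X * ratioSub) = theta X * haupt := by
  have h := pow_mul_theta_mul_ratioSub 1
  rw [pow_one ratioSub] at h
  have h2 := sect_four_of_mul_eq (g₀ := 4 * theta X * quarticDiff)
    (g₁ := 2 * theta X ^ 4 + 2 * quarticDiff) (g₂ := 4 * theta X ^ 3) (g₃ := 4 * theta X ^ 2)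
    (h.trans ?_)
  · refine mul_left_cancel₀ (pow_ne_zero 1 (pow_ne_zero 4 theta_neg_ne_zero)) (h2.trans ?_)
    linear_combination -theta X * haupt_mul
  · simp only [map_mul, map_add, map_pow, map_ofNat, ← thetaOdd_pow_four]
    ring

lemma sect_four_theta_mul_ratioSub_sq :
    sect 4 (theta X * ratioSub ^ 2) = theta X * (5 * haupt + 2 * haupt ^ 2) := by
  have h := pow_mul_theta_mul_ratioSub 2
  have h2 := sect_four_of_mul_eq (g₀ := 20 * theta X ^ 5 * quarticDiff
    + 12 * theta X * quarticDiff ^ 2)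
    (g₁ := 28 * theta X ^ 4 * quarticDiff + 4 * quarticDiff ^ 2)
    (g₂ := 4 * theta X ^ 7 + 28 * theta X ^ 3 * quarticDiff)
    (g₃ := 12 * theta X ^ 6 + 20 * theta X ^ 2 * quarticDiff)
    (h.trans ?_)
  · refine mul_left_cancel₀ (pow_ne_zero 2 (pow_ne_zero 4 theta_neg_ne_zero)) (h2.trans ?_)
    have h3 := haupt_mul
    have h4 : theta X ^ 4 = theta (-X) ^ 4 + quarticDiff := by rw [quarticDiff]; ring
    linear_combination 20 * theta X * quarticDiff * h4
      - theta X * (5 * theta (-X) ^ 4 + 2 * (haupt * theta (-X) ^ 4 + 4 * quarticDiff)) * h3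
  · simp only [map_mul, map_add, map_pow, map_ofNat, ← thetaOdd_pow_four]
    ring

lemma sect_four_theta_mul_ratioSub_cube :
    sect 4 (theta X * ratioSub ^ 3) = theta X * (8 * haupt + 16 * haupt ^ 2 + 4 * haupt ^ 3) := by
  have h := pow_mul_theta_mul_ratioSub 3
  have h2 := sect_four_of_mul_eq (g₀ := 8 * (4 * theta X ^ 9 * quarticDiff
    + 24 * theta X ^ 5 * quarticDiff ^ 2 + 4 * theta X * quarticDiff ^ 3))
    (g₁ := 8 * (9 * theta X ^ 8 * quarticDiff + 22 * theta X ^ 4 * quarticDiff ^ 2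
      + quarticDiff ^ 3))
    (g₂ := 8 * (16 * theta X ^ 7 * quarticDiff + 16 * theta X ^ 3 * quarticDiff ^ 2))
    (g₃ := 8 * (theta X ^ 10 + 22 * theta X ^ 6 * quarticDiff + 9 * theta X ^ 2 * quarticDiff ^ 2))
    (h.trans ?_)
  · refine mul_left_cancel₀ (pow_ne_zero 3 (pow_ne_zero 4 theta_neg_ne_zero)) (h2.trans ?_)
    have h3 := haupt_mul
    have h4 : theta X ^ 4 = theta (-X) ^ 4 + quarticDiff := by rw [quarticDiff]; ring
    have h5 (n : ℕ) : (haupt * theta (-X) ^ 4) ^ n = (4 * quarticDiff) ^ n := by rw [h3]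
    linear_combination 32 * theta X * quarticDiff * (theta X ^ 4 + theta (-X) ^ 4 + quarticDiff) * h4
      + 192 * theta X * quarticDiff ^ 2 * h4 - 8 * theta X * theta (-X) ^ 8 * h5 1
      - 16 * theta X * theta (-X) ^ 4 * h5 2 - 4 * theta X * h5 3
  · simp only [map_mul, map_add, map_pow, map_ofNat, ← thetaOdd_pow_four]
    ring

lemma sect_four_theta_mul_ratioSub_pow (k : ℕ) :
    sect 4 (theta X * ratioSub ^ (k + 4)) = haupt * (2 * sect 4 (theta X * ratioSub ^ (k + 3))
      + 6 * sect 4 (theta X * ratioSub ^ (k + 2)) + 8 * sect 4 (theta X * ratioSub ^ (k + 1))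
      + 4 * sect 4 (theta X * ratioSub ^ k)) := by
  have h : theta X * ratioSub ^ (k + 4) = expandFour haupt *
      ((2 : ℕ) • (theta X * ratioSub ^ (k + 3)) + (6 : ℕ) • (theta X * ratioSub ^ (k + 2))
      + (8 : ℕ) • (theta X * ratioSub ^ (k + 1)) + (4 : ℕ) • (theta X * ratioSub ^ k)) := by
    simp only [nsmul_eq_mul]
    push_cast
    linear_combination theta X * ratioSub ^ k * ratioSub_pow_four
  rw [h, sect_expand_mul]
  simp only [map_add, map_nsmul]
  simp only [nsmul_eq_mul]
  push_cast
  ring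

/-! ### The module `φ h ℤ[h]` and its contraction by 8. -/

/-- The additive group `φ · h · ℤ[h]`, where `h = haupt`. -/
noncomputable def hauptModule : AddSubgroup ℤ⟦X⟧ :=
  AddMonoidHom.range ((AddMonoidHom.mulLeft (theta X * haupt)).comp
    (Polynomial.aeval haupt : Polynomial ℤ →ₐ[ℤ] ℤ⟦X⟧).toRingHom.toAddMonoidHom)

lemma mem_hauptModule {f : ℤ⟦X⟧} :
    f ∈ hauptModule ↔ ∃ p : Polynomial ℤ, f = theta X * haupt * Polynomial.aeval haupt p := by
  simp [hauptModule, AddMonoidHom.mem_range, eq_comm]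

lemma haupt_mul_mem {f : ℤ⟦X⟧} (h : f ∈ hauptModule) : haupt * f ∈ hauptModule := by
  obtain ⟨p, rfl⟩ := mem_hauptModule.1 h
  refine mem_hauptModule.2 ⟨Polynomial.X * p, ?_⟩
  rw [map_mul, Polynomial.aeval_X]
  ring

lemma ofNat_mul_mem {f : ℤ⟦X⟧} (n : ℕ) (h : f ∈ hauptModule) : (n : ℤ⟦X⟧) * f ∈ hauptModule := by
  rw [← nsmul_eq_mul]
  exact hauptModule.nsmul_mem h n

lemma theta_mul_haupt_mem : theta X * haupt ∈ hauptModule :=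
  mem_hauptModule.2 ⟨1, by simp⟩

/-- The cases `r`, `r^2`, `r^3` are explicit; the modular equation gives a recurrence for higher
powers. At `r^4` the recurrence reaches `U φ = φ`, which is outside the module, but it enters
multiplied by `h`. -/
lemma sect_four_mem (k : ℕ) : sect 4 (theta X * ratioSub ^ (k + 1)) ∈ hauptModule := by
  induction k using Nat.strong_induction_on with
  | _ k ih =>
    match k with
    | 0 =>
      rw [zero_add, pow_one, sect_four_theta_mul_ratioSub]
      exact theta_mul_haupt_mem
    | 1 =>
      rw [sect_four_theta_mul_ratioSub_sq]
      refine mem_hauptModule.2 ⟨5 + 2 * Polynomial.X, ?_⟩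
      simp only [map_add, map_mul, map_ofNat, Polynomial.aeval_X]
      ring
    | 2 =>
      rw [sect_four_theta_mul_ratioSub_cube]
      refine mem_hauptModule.2 ⟨8 + 16 * Polynomial.X + 4 * Polynomial.X ^ 2, ?_⟩
      simp only [map_add, map_mul, map_pow, map_ofNat, Polynomial.aeval_X]
      ring
    | 3 =>
      rw [show 3 + 1 = 0 + 4 from rfl, sect_four_theta_mul_ratioSub_pow, pow_zero, mul_one,
        sect_four_theta, mul_add]
      refine add_mem (haupt_mul_mem (add_mem (add_mem (ofNat_mul_mem 2 (ih 2 (by norm_num)))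
        (ofNat_mul_mem 6 (ih 1 (by norm_num)))) (ofNat_mul_mem 8 (ih 0 (by norm_num))))) ?_
      rw [show haupt * (4 * theta X) = ((4 : ℕ) : ℤ⟦X⟧) * (theta X * haupt) by push_cast; ring]
      exact ofNat_mul_mem 4 theta_mul_haupt_mem
    | k + 4 =>
      rw [show k + 4 + 1 = (k + 1) + 4 by ring, sect_four_theta_mul_ratioSub_pow]
      exact haupt_mul_mem (add_mem (add_mem (add_mem (ofNat_mul_mem 2 (ih (k + 3) (by omega)))
        (ofNat_mul_mem 6 (ih (k + 2) (by omega)))) (ofNat_mul_mem 8 (ih (k + 1) (by omega))))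
        (ofNat_mul_mem 4 (ih k (by omega))))

lemma sect_four_theta_mul_aeval_mem (p : Polynomial ℤ) :
    sect 4 (theta X * ratioSub * Polynomial.aeval ratioSub p) ∈ hauptModule := by
  induction p using Polynomial.induction_on' with
  | add p q hp hq =>
    rw [map_add, mul_add, map_add]
    exact add_mem hp hq
  | monomial n c =>
    rw [Polynomial.aeval_monomial, show theta X * ratioSub * (algebraMap ℤ ℤ⟦X⟧ c * ratioSub ^ n) =
      c • (theta X * ratioSub ^ (n + 1)) by rw [zsmul_eq_mul, eq_intCast]; ring, map_zsmul]
    exact hauptModule.zsmul_mem (sect_four_mem n) c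

/-- In `h = 16r + 24r^2 + 16r^3 + 4r^4` only the last coefficient is not divisible by 8, and the
quartic expresses `r^4` with even coefficients. -/
lemma sect_four_theta_mul_haupt : ∃ m ∈ hauptModule, sect 4 (theta X * haupt) = 8 * m := by
  have h : theta X * haupt = (16 : ℕ) • (theta X * ratioSub) + (24 : ℕ) • (theta X * ratioSub ^ 2)
      + (16 : ℕ) • (theta X * ratioSub ^ 3) + (4 : ℕ) • (theta X * ratioSub ^ (0 + 4)) := by
    simp only [nsmul_eq_mul, haupt]
    push_cast
    ring
  have h4 := sect_four_theta_mul_ratioSub_pow 0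
  rw [pow_zero, mul_one, sect_four_theta] at h4
  rw [h]
  simp only [map_add, map_nsmul, h4]
  simp only [nsmul_eq_mul]
  refine ⟨((2 : ℕ) : ℤ⟦X⟧) * sect 4 (theta X * ratioSub ^ (0 + 1))
    + ((3 : ℕ) : ℤ⟦X⟧) * sect 4 (theta X * ratioSub ^ (1 + 1))
    + ((2 : ℕ) : ℤ⟦X⟧) * sect 4 (theta X * ratioSub ^ (2 + 1))
    + (haupt * (sect 4 (theta X * ratioSub ^ (2 + 1))
      + ((3 : ℕ) : ℤ⟦X⟧) * sect 4 (theta X * ratioSub ^ (1 + 1))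
      + ((4 : ℕ) : ℤ⟦X⟧) * sect 4 (theta X * ratioSub ^ (0 + 1)))
      + ((2 : ℕ) : ℤ⟦X⟧) * (theta X * haupt)), ?_, ?_⟩
  · exact add_mem (add_mem (add_mem (ofNat_mul_mem _ (sect_four_mem _))
      (ofNat_mul_mem _ (sect_four_mem _))) (ofNat_mul_mem _ (sect_four_mem _)))
      (add_mem (haupt_mul_mem (add_mem (add_mem (sect_four_mem _)
      (ofNat_mul_mem _ (sect_four_mem _))) (ofNat_mul_mem _ (sect_four_mem _))))
      (ofNat_mul_mem _ theta_mul_haupt_mem))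
  · push_cast
    norm_num only [pow_one]
    ring

lemma sect_four_hauptModule {f : ℤ⟦X⟧} (hf : f ∈ hauptModule) :
    ∃ m ∈ hauptModule, sect 4 f = 8 * m := by
  obtain ⟨p, rfl⟩ := mem_hauptModule.1 hf
  obtain ⟨m, hm, hm'⟩ := sect_four_theta_mul_haupt
  set W : Polynomial ℤ := Polynomial.X ^ 3 + 4 * Polynomial.X ^ 2 + 6 * Polynomial.X + 4 with hW
  have h1 : haupt = 4 * (ratioSub * Polynomial.aeval ratioSub W) := by
    simp only [hW, map_add, map_mul, map_pow, map_ofNat, Polynomial.aeval_X, haupt]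
    ring
  have h2 : haupt = Polynomial.aeval ratioSub (4 * Polynomial.X * W) := by
    rw [map_mul, map_mul, map_ofNat, Polynomial.aeval_X, h1]
    ring
  have h3 : Polynomial.aeval haupt p = algebraMap ℤ ℤ⟦X⟧ (p.coeff 0)
      + haupt * Polynomial.aeval haupt p.divX := by
    conv_lhs => rw [← Polynomial.divX_mul_X_add p]
    rw [map_add, map_mul, Polynomial.aeval_X, Polynomial.aeval_C]
    ring
  have h4 : Polynomial.aeval haupt p.divX =
      Polynomial.aeval ratioSub (p.divX.comp (4 * Polynomial.X * W)) := by
    rw [Polynomial.aeval_comp, ← h2]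
  -- Beyond its linear term in `h`, the element is a multiple of `h^2 = 16 r^2 W(r)^2`, which
  -- supplies the factor 8 with a 2 to spare.
  have h5 : theta X * haupt * Polynomial.aeval haupt p = p.coeff 0 • (theta X * haupt)
      + (16 : ℕ) • (theta X * ratioSub * Polynomial.aeval ratioSub
        (Polynomial.X * W ^ 2 * p.divX.comp (4 * Polynomial.X * W))) := by
    rw [h3, zsmul_eq_mul, nsmul_eq_mul, h4, eq_intCast]
    simp only [map_mul, map_pow, Polynomial.aeval_X]
    push_cast
    linear_combination theta X * (haupt + 4 * (ratioSub * Polynomial.aeval ratioSub W)) *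
      Polynomial.aeval ratioSub (p.divX.comp (4 * Polynomial.X * W)) * h1
  refine ⟨p.coeff 0 • m + (2 : ℕ) • sect 4 (theta X * ratioSub * Polynomial.aeval ratioSub
        (Polynomial.X * W ^ 2 * p.divX.comp (4 * Polynomial.X * W))),
    add_mem (hauptModule.zsmul_mem hm _)
      (hauptModule.nsmul_mem (sect_four_theta_mul_aeval_mem _) _), ?_⟩
  rw [h5, map_add, map_zsmul, map_nsmul, hm']
  simp only [nsmul_eq_mul, zsmul_eq_mul]
  push_cast
  ring

/-! ### Iterating the section operator on `F`. -/

/-- The generating function of `2 v0(4n) - [n = 0]`. -/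
noncomputable def quarticSection : ℤ⟦X⟧ := 2 * mk (fun n => v0 (4 * n)) - 1

lemma quarticSection_eq : quarticSection = theta X * (1 + ratioSub) := by
  refine mul_right_cancel₀ theta_neg_ne_zero ?_
  rw [quarticSection, quartic_section_mul_theta_neg, one_add_ratioSub]
  linear_combination -theta X ^ 2 * theta_neg_mul_inv

lemma coeff_quarticSection {n : ℕ} (hn : n ≠ 0) : coeff n quarticSection = 2 * v0 (4 * n) := by
  rw [quarticSection, two_mul, map_sub, map_add, coeff_mk, coeff_one, if_neg hn]
  ring

lemma coeff_sect_four_iterate (α n : ℕ) (f : ℤ⟦X⟧) :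
    coeff n ((sect 4)^[α] f) = coeff (4 ^ α * n) f := by
  induction α generalizing f with
  | zero => simp
  | succ α ih =>
    rw [Function.iterate_succ_apply, ih, coeff_sect]
    ring_nf

lemma sect_four_iterate_quarticSection (α : ℕ) :
    ∃ m ∈ hauptModule, (sect 4)^[α + 1] quarticSection = theta X + 8 ^ α * m := by
  induction α with
  | zero =>
    refine ⟨theta X * haupt, theta_mul_haupt_mem, ?_⟩
    rw [zero_add, Function.iterate_one, quarticSection_eq, mul_add, mul_one, map_add,
      sect_four_theta, sect_four_theta_mul_ratioSub]
    ring
  | succ α ih =>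
    obtain ⟨m, hm, h⟩ := ih
    obtain ⟨m', hm', h'⟩ := sect_four_hauptModule hm
    refine ⟨m', hm', ?_⟩
    rw [Function.iterate_succ_apply', h, map_add, sect_four_theta,
      show (8 ^ α * m : ℤ⟦X⟧) = (8 ^ α : ℕ) • m by rw [nsmul_eq_mul]; push_cast; ring,
      map_nsmul, h', nsmul_eq_mul]
    push_cast
    ring

/-! ### Parity of the theta series and supports modulo 8. -/

lemma coeff_natCast_mul (k n : ℕ) (f : ℤ⟦X⟧) : coeff n ((k : ℤ⟦X⟧) * f) = k * coeff n f := by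
  rw [← nsmul_eq_mul, map_nsmul, nsmul_eq_mul]

lemma exists_eq_natCast_mul {f : ℤ⟦X⟧} {k : ℕ} (hf : ∀ n, (k : ℤ) ∣ coeff n f) :
    ∃ g : ℤ⟦X⟧, f = k * g := by
  choose g hg using hf
  refine ⟨mk g, ?_⟩
  ext n
  rw [coeff_natCast_mul, coeff_mk, hg]

lemma exists_eq_one_add_two_mul {f : ℤ⟦X⟧} (h0 : coeff 0 f = 1)
    (hf : ∀ n, n ≠ 0 → (2 : ℤ) ∣ coeff n f) : ∃ u, f = 1 + 2 * u := by
  obtain ⟨u, hu⟩ := exists_eq_natCast_mul (f := f - 1) (k := 2) fun n => by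
    rcases eq_or_ne n 0 with rfl | hn
    · rw [map_sub, h0]; simp
    · rw [map_sub, coeff_one, if_neg hn, sub_zero]
      exact hf n hn
  exact ⟨u, by push_cast at hu; linear_combination hu⟩

lemma exists_theta_eq : ∃ u, theta X = 1 + 2 * u :=
  exists_eq_one_add_two_mul coeff_theta_zero fun _ => two_dvd_coeff_theta

lemma exists_thetaNegInv_eq : ∃ u, thetaNegInv = 1 + 2 * u := by
  obtain ⟨u, hu⟩ : ∃ u, theta (-X) = 1 + 2 * u := by
    rw [← evalNegHom_theta]
    refine exists_eq_one_add_two_mul ?_ fun n hn => ?_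
    · rw [coeff_evalNegHom, coeff_theta_zero]; simp
    · rw [coeff_evalNegHom]; exact (two_dvd_coeff_theta hn).mul_left _
  refine ⟨-u * thetaNegInv, ?_⟩
  have h := theta_neg_mul_inv
  rw [hu] at h
  linear_combination h

lemma exists_thetaOdd_eq : ∃ b, thetaOdd = 2 * b ∧ SupportedMod 8 1 b := by
  obtain ⟨b, hb⟩ := exists_eq_natCast_mul (f := thetaOdd) (k := 2) fun n => by
    rw [coeff_thetaOdd]
    split_ifs with h
    · exact two_dvd_coeff_theta (by omega)
    · exact dvd_zero _
  refine ⟨b, by simpa using hb, fun n hn => supportedMod_thetaOdd n ?_⟩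
  rw [hb, coeff_natCast_mul]
  exact mul_ne_zero (by norm_num) hn

/-- The series in `q^m`. -/
def supportedSubring (m : ℕ) : Subring ℤ⟦X⟧ where
  carrier := {f | SupportedMod m 0 f}
  mul_mem' hf hg := hf.mul hg
  one_mem' := SupportedMod.one
  add_mem' hf hg := hf.add hg
  zero_mem' := fun n hn => absurd (map_zero _) hn
  neg_mem' {f} hf := fun n hn => hf n (by simpa using hn)

lemma SupportedMod.mul_mem {m r : ℕ} {f g : ℤ⟦X⟧} (hf : SupportedMod m r f)
    (hg : g ∈ supportedSubring m) : SupportedMod m r (f * g) := by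
  simpa using hf.mul hg

lemma expandFour_mem (f : ℤ⟦X⟧) : expandFour f ∈ supportedSubring 4 :=
  SupportedMod.expand_zero 4 four_ne_zero f

lemma expandFour_expandFour_mem (f : ℤ⟦X⟧) : expandFour (expandFour f) ∈ supportedSubring 8 :=
  ((SupportedMod.expand_zero 4 four_ne_zero f).expand 4 four_ne_zero).of_dvd (by norm_num)

lemma expandFour_expand_two_mem (f : ℤ⟦X⟧) :
    expandFour (PowerSeries.expand 2 two_ne_zero f) ∈ supportedSubring 8 :=
  ((SupportedMod.expand_zero 2 two_ne_zero f).expand 4 four_ne_zero).of_dvd (by norm_num)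

lemma expandFour_theta : expandFour (theta X) =
    expandFour (expandFour (theta X)) + expandFour thetaOdd := by
  rw [← map_add, ← theta_eq]

lemma expandFour_theta_neg : expandFour (theta (-X)) =
    expandFour (expandFour (theta X)) - expandFour thetaOdd := by
  rw [← map_sub, ← theta_neg_eq]

lemma supportedMod_expandFour {f : ℤ⟦X⟧} (h : SupportedMod 8 1 f) :
    SupportedMod 8 4 (expandFour f) := (h.expand 4 four_ne_zero).of_dvd (by norm_num)

/-! ### Divisibility at non-square indices congruent to 1 modulo 8. -/

/-- Only the part supported in the class of `1` modulo `8` contributes to the coefficients there. -/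
lemma coeff_add_supported {f o₀ o₂ o₃ o₅ : ℤ⟦X⟧} (h₀ : o₀ ∈ supportedSubring 4)
    (h₂ : SupportedMod 4 2 o₂) (h₃ : SupportedMod 4 3 o₃) (h₅ : SupportedMod 8 5 o₅) {N : ℕ}
    (hN : N % 8 = 1) : coeff N (f + o₀ + o₂ + o₃ + o₅) = coeff N f := by
  rw [map_add, map_add, map_add, map_add, SupportedMod.coeff_eq_zero h₀, h₂.coeff_eq_zero,
    h₃.coeff_eq_zero, h₅.coeff_eq_zero]
  · ring
  all_goals intro h; unfold Nat.ModEq at h; omega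

lemma coeff_thetaOdd_of_not_isSquare {N : ℕ} (hsq : ¬ IsSquare N) : coeff N thetaOdd = 0 := by
  rw [coeff_thetaOdd, coeff_theta_of_not_isSquare hsq, ite_self]

lemma thetaNegInv_eq : thetaNegInv = (expandFour (theta X) + thetaOdd) *
    (expandFour (theta X) ^ 2 + thetaOdd ^ 2) * expandFour thetaNegInv ^ 4 := by
  have h : expandFour (theta (-X) ^ 4) * expandFour thetaNegInv ^ 4 = 1 := by
    rw [← map_pow, ← map_mul, ← mul_pow, theta_neg_mul_inv, one_pow, map_one]
  rw [← expandFour_theta_pow_sub] at h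
  linear_combination -thetaNegInv * h + (expandFour (theta X) + thetaOdd) *
    (expandFour (theta X) ^ 2 + thetaOdd ^ 2) * expandFour thetaNegInv ^ 4 * sub_thetaOdd_mul_inv

lemma expandFour_theta_pow_mul_inv :
    (expandFour (theta X) ^ 4 - thetaOdd ^ 4) * expandFour thetaNegInv ^ 4 = 1 := by
  rw [expandFour_theta_pow_sub, ← map_pow, ← map_mul, ← mul_pow, theta_neg_mul_inv, one_pow,
    map_one]

/-- The terms of class 1 mod 4 are `b(3a^4 + b^4) I^4 = 3b + 4b^5 I^4`, with `b^4 = 8cd(c^2 + d^2)`.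
Expanding `I^4 = (c + d)^4 J^4` by parity in `d` separates the classes 1 and 5 mod 8. -/
lemma quarticSection_identity {a b c d I J : ℤ⟦X⟧} (ha : a = c + d) (hI : I = (c + d) * J)
    (hJ : (c ^ 2 - d ^ 2) * J = 1) (hb : b ^ 4 = a ^ 4 - (c - d) ^ 4) :
    (a + b) ^ 3 * (a ^ 2 + b ^ 2) * I ^ 4 =
      3 * b + 128 * (b * J ^ 4 * c ^ 2 * d ^ 2 * (c ^ 2 + d ^ 2) ^ 2)
      + I ^ 4 * (a ^ 5 + 3 * a * b ^ 4) + b ^ 2 * (4 * a ^ 3 * I ^ 4) + b ^ 3 * (4 * a ^ 2 * I ^ 4)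
      + b * d * (32 * J ^ 4 * c *
        (c ^ 6 + 7 * c ^ 4 * d ^ 2 + 7 * c ^ 2 * (d ^ 2) ^ 2 + (d ^ 2) ^ 3)) := by
  subst ha hI
  have hJ4 : ((c ^ 2 - d ^ 2) * J) ^ 4 = 1 := by rw [hJ, one_pow]
  linear_combination ((c + d) * J) ^ 4 * b * hb + 3 * b * hJ4

lemma pow_dvd_coeff_quarticSection {N : ℕ} (hN : N % 8 = 1) (hsq : ¬ IsSquare N) :
    (2 : ℤ) ^ 10 ∣ coeff N quarticSection := by
  obtain ⟨b', hb', hs'⟩ := exists_thetaOdd_eq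
  have hb : SupportedMod 4 1 thetaOdd := supportedMod_thetaOdd.of_dvd (by norm_num)
  have hi := thetaNegInv_eq
  have hD2 := expandFour_theta_pow_sub
  have hac := expandFour_theta
  have hc : expandFour (expandFour (theta X)) ∈ supportedSubring 8 := expandFour_expandFour_mem _
  have hd : SupportedMod 8 4 (expandFour thetaOdd) := supportedMod_expandFour supportedMod_thetaOdd
  have hd2 : expandFour thetaOdd ^ 2 ∈ supportedSubring 8 := (hd.pow 2).congr (by decide)
  -- Here `c = φ(q^16)`, `d` is the odd part of `φ` at `q^4`, and `J = 1/φ(-q^8)^2`, a series in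
  -- `q^8`.
  have hJ : ∃ J ∈ supportedSubring 8,
      (expandFour (expandFour (theta X)) ^ 2 - expandFour thetaOdd ^ 2) * J = 1 := by
    refine ⟨expandFour (PowerSeries.expand 2 two_ne_zero (thetaNegInv ^ 2)),
      expandFour_expand_two_mem _, ?_⟩
    have h1 : expandFour (expandFour (theta X)) ^ 2 - expandFour thetaOdd ^ 2 =
        expandFour (theta X * theta (-X)) := by
      rw [map_mul, expandFour_theta_neg]
      linear_combination -(expandFour (expandFour (theta X)) - expandFour thetaOdd) * hac
    rw [h1, theta_mul_theta_neg, ← map_pow, ← map_mul, ← map_mul, ← mul_pow, theta_neg_mul_inv,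
      one_pow, map_one, map_one]
  obtain ⟨J, hJm, hJ⟩ := hJ
  have hI : expandFour thetaNegInv =
      (expandFour (expandFour (theta X)) + expandFour thetaOdd) * J := by
    have h1 : expandFour (theta (-X)) * expandFour thetaNegInv = 1 := by
      rw [← map_mul, theta_neg_mul_inv, map_one]
    rw [expandFour_theta_neg] at h1
    linear_combination -expandFour thetaNegInv * hJ +
      (expandFour (expandFour (theta X)) + expandFour thetaOdd) * J * h1
  have hdd : expandFour thetaOdd = 2 * expandFour b' := by rw [hb', map_mul, map_ofNat]
  have hIm : expandFour thetaNegInv ∈ supportedSubring 4 := expandFour_mem _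
  have ham : expandFour (theta X) ∈ supportedSubring 4 := expandFour_mem _
  have hbm : thetaOdd ^ 4 ∈ supportedSubring 4 := (hb.pow 4).congr (by decide)
  rw [map_pow, expandFour_theta_neg] at hD2
  -- The constant is `1024 = 128 · 2 · 2^2`: one 2 from `b = 2b'` and two from `d^2`.
  have hF : quarticSection = (3 * thetaOdd + (1024 : ℕ) * (b' * J ^ 4 *
        expandFour (expandFour (theta X)) ^ 2 * expandFour b' ^ 2 *
        (expandFour (expandFour (theta X)) ^ 2 + expandFour thetaOdd ^ 2) ^ 2))
      + expandFour thetaNegInv ^ 4 * (expandFour (theta X) ^ 5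
        + 3 * expandFour (theta X) * thetaOdd ^ 4)
      + thetaOdd ^ 2 * (4 * expandFour (theta X) ^ 3 * expandFour thetaNegInv ^ 4)
      + thetaOdd ^ 3 * (4 * expandFour (theta X) ^ 2 * expandFour thetaNegInv ^ 4)
      + thetaOdd * expandFour thetaOdd * (32 * J ^ 4 * expandFour (expandFour (theta X)) *
        (expandFour (expandFour (theta X)) ^ 6
          + 7 * expandFour (expandFour (theta X)) ^ 4 * expandFour thetaOdd ^ 2
          + 7 * expandFour (expandFour (theta X)) ^ 2 * (expandFour thetaOdd ^ 2) ^ 2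
          + (expandFour thetaOdd ^ 2) ^ 3)) := by
    rw [quarticSection_eq, one_add_ratioSub]
    have hF1 : theta X * (theta X * thetaNegInv) =
        (expandFour (theta X) + thetaOdd) ^ 3 * (expandFour (theta X) ^ 2 + thetaOdd ^ 2) *
          expandFour thetaNegInv ^ 4 := by
      conv_lhs => rw [hi]
      rw [show theta X * (theta X * ((expandFour (theta X) + thetaOdd) *
        (expandFour (theta X) ^ 2 + thetaOdd ^ 2) * expandFour thetaNegInv ^ 4)) =
        theta X ^ 2 * ((expandFour (theta X) + thetaOdd) *
        (expandFour (theta X) ^ 2 + thetaOdd ^ 2) * expandFour thetaNegInv ^ 4) by ring,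
        show theta X ^ 2 = (expandFour (theta X) + thetaOdd) ^ 2 by rw [← theta_eq]]
      ring
    rw [hF1]
    push_cast
    have hb4 : thetaOdd ^ 4 = expandFour (theta X) ^ 4
        - (expandFour (expandFour (theta X)) - expandFour thetaOdd) ^ 4 := by
      linear_combination -hD2
    rw [quarticSection_identity hac hI hJ hb4, show 128 * (thetaOdd * J ^ 4 *
        expandFour (expandFour (theta X)) ^ 2 * expandFour thetaOdd ^ 2 *
        (expandFour (expandFour (theta X)) ^ 2 + expandFour thetaOdd ^ 2) ^ 2) =
        1024 * (b' * J ^ 4 * expandFour (expandFour (theta X)) ^ 2 * expandFour b' ^ 2 *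
        (expandFour (expandFour (theta X)) ^ 2 + expandFour thetaOdd ^ 2) ^ 2) by
      rw [show thetaOdd * J ^ 4 * expandFour (expandFour (theta X)) ^ 2 * expandFour thetaOdd ^ 2 =
        8 * (b' * J ^ 4 * expandFour (expandFour (theta X)) ^ 2 * expandFour b' ^ 2) by
          rw [hdd]
          linear_combination 4 * J ^ 4 * expandFour (expandFour (theta X)) ^ 2
            * expandFour b' ^ 2 * hb']
      ring]
  rw [hF, coeff_add_supported _ _ _ _ hN, map_add, coeff_natCast_mul,
    show (3 : ℤ⟦X⟧) = ((3 : ℕ) : ℤ⟦X⟧) by norm_num, coeff_natCast_mul,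
    coeff_thetaOdd_of_not_isSquare hsq]
  · norm_num
  · refine mul_mem (pow_mem hIm 4) (add_mem (pow_mem ham 5) (mul_mem (mul_mem ?_ ham) hbm))
    exact ofNat_mem _ 3
  · exact (hb.pow 2).mul_mem (mul_mem (mul_mem (ofNat_mem _ 4) (pow_mem ham 3)) (pow_mem hIm 4))
  · exact (hb.pow 3).mul_mem (mul_mem (mul_mem (ofNat_mem _ 4) (pow_mem ham 2)) (pow_mem hIm 4))
  · refine (supportedMod_thetaOdd.mul hd).mul_mem (mul_mem (mul_mem (mul_mem (ofNat_mem _ 32)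
      (pow_mem hJm 4)) hc) ?_)
    exact add_mem (add_mem (add_mem (pow_mem hc 6) (mul_mem (mul_mem (ofNat_mem _ 7)
      (pow_mem hc 4)) hd2)) (mul_mem (mul_mem (ofNat_mem _ 7) (pow_mem hc 2)) (pow_mem hd2 2)))
      (pow_mem hd2 3)

/-- The part of `φ h` with exponents congruent to `1` modulo `4`. -/
lemma theta_mul_haupt_identity {a b I : ℤ⟦X⟧} (hI : (a ^ 4 - b ^ 4) * I ^ 4 = 1) :
    4 * ((a + b) ^ 9 * (a ^ 2 + b ^ 2) ^ 4 * I ^ 16 - (a + b)) =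
      32 * b * (1 + 69 * (b * I) ^ 4 + 356 * (b * I) ^ 8 + 544 * (b * I) ^ 12
        + 256 * (b * I) ^ 16)
      + 4 * a * ((a ^ 16 + 276 * a ^ 12 * b ^ 4 + 1246 * a ^ 8 * (b ^ 4) ^ 2
        + 516 * a ^ 4 * (b ^ 4) ^ 3 + 9 * (b ^ 4) ^ 4) * I ^ 16 - 1)
      + b ^ 2 * (4 * a ^ 3 * (40 * a ^ 12 + 808 * a ^ 8 * b ^ 4 + 1080 * a ^ 4 * (b ^ 4) ^ 2
        + 120 * (b ^ 4) ^ 3) * I ^ 16)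
      + b ^ 3 * (4 * a ^ 2 * (120 * a ^ 12 + 1080 * a ^ 8 * b ^ 4 + 808 * a ^ 4 * (b ^ 4) ^ 2
        + 40 * (b ^ 4) ^ 3) * I ^ 16) := by
  -- This eliminates `a` from the class 1 mod 4, leaving a polynomial in `(bI)^4`.
  have h : (a * I) ^ 4 = 1 + (b * I) ^ 4 := by linear_combination hI
  have h8 : (a * I) ^ 8 = (1 + (b * I) ^ 4) ^ 2 := by rw [← h]; ring
  have h12 : (a * I) ^ 12 = (1 + (b * I) ^ 4) ^ 3 := by rw [← h]; ring
  have h16 : (a * I) ^ 16 = (1 + (b * I) ^ 4) ^ 4 := by rw [← h]; ring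
  linear_combination 4 * b * (9 * h16 + 516 * (b * I) ^ 4 * h12 + 1246 * (b * I) ^ 8 * h8
    + 276 * (b * I) ^ 12 * h)

lemma theta_mul_haupt_eq : theta X * haupt = 4 * ((expandFour (theta X) + thetaOdd) ^ 9 *
    (expandFour (theta X) ^ 2 + thetaOdd ^ 2) ^ 4 * expandFour thetaNegInv ^ 16
    - (expandFour (theta X) + thetaOdd)) := by
  rw [haupt, one_add_ratioSub]
  have h : (theta X * thetaNegInv) ^ 4 = theta X ^ 4 * ((expandFour (theta X) + thetaOdd) *
      (expandFour (theta X) ^ 2 + thetaOdd ^ 2) * expandFour thetaNegInv ^ 4) ^ 4 := by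
    rw [mul_pow]; conv_lhs => rw [thetaNegInv_eq]
  rw [h]
  have h2 := theta_eq
  generalize expandFour (theta X) ^ 2 + thetaOdd ^ 2 = v
  generalize expandFour (theta X) + thetaOdd = u at h2 ⊢
  rw [h2]
  ring

lemma pow_dvd_coeff_theta_mul_haupt {N : ℕ} (hN : N % 8 = 1) (hsq : ¬ IsSquare N) :
    (2 : ℤ) ^ 13 ∣ coeff N (theta X * haupt) := by
  obtain ⟨b', hb', hs'⟩ := exists_thetaOdd_eq
  obtain ⟨k, hk⟩ := exists_thetaNegInv_eq
  have hb : SupportedMod 4 1 thetaOdd := supportedMod_thetaOdd.of_dvd (by norm_num)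
  have hac := expandFour_theta
  have hc : expandFour (expandFour (theta X)) ∈ supportedSubring 8 := expandFour_expandFour_mem _
  have hd : SupportedMod 8 4 (expandFour thetaOdd) := supportedMod_expandFour supportedMod_thetaOdd
  have hd2 : expandFour thetaOdd ^ 2 ∈ supportedSubring 8 := (hd.pow 2).congr (by decide)
  have hd' : SupportedMod 8 4 (expandFour b') := supportedMod_expandFour hs'
  have hIm : expandFour thetaNegInv ∈ supportedSubring 4 := expandFour_mem _
  have ham : expandFour (theta X) ∈ supportedSubring 4 := expandFour_mem _
  have hbm : thetaOdd ^ 4 ∈ supportedSubring 4 := (hb.pow 4).congr (by decide)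
  have hdd : expandFour thetaOdd = 2 * expandFour b' := by rw [hb', map_mul, map_ofNat]
  have hkk : expandFour thetaNegInv = 1 + 2 * expandFour k := by
    rw [hk, map_add, map_mul, map_one, map_ofNat]
  have hb4 : thetaOdd ^ 4 = 16 * expandFour (expandFour (theta X)) * expandFour b' *
      (expandFour (expandFour (theta X)) ^ 2 + expandFour thetaOdd ^ 2) := by
    have hD2 := expandFour_theta_pow_sub
    rw [map_pow, expandFour_theta_neg] at hD2
    have hD3 : expandFour (theta X) ^ 4 =
        (expandFour (expandFour (theta X)) + expandFour thetaOdd) ^ 4 := by rw [← hac]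
    linear_combination -hD2 + hD3 + 8 * expandFour (expandFour (theta X)) *
      (expandFour (expandFour (theta X)) ^ 2 + expandFour thetaOdd ^ 2) * hdd
  obtain ⟨m, hm⟩ : ∃ m, expandFour thetaNegInv ^ 4 = 1 + 8 * m :=
    ⟨expandFour k + 3 * expandFour k ^ 2 + 4 * expandFour k ^ 3 + 2 * expandFour k ^ 4, by
      rw [hkk]; ring⟩
  rw [theta_mul_haupt_eq, theta_mul_haupt_identity expandFour_theta_pow_mul_inv]
  -- The term in `b^5` is `70656 = 69 · 2^10` times a series of class 5 mod 8, up to `I^4 = 1 + 8m`;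
  -- so its contribution to class 1 is divisible by `2^13`. Higher powers of `b = 2b'` are divisible
  -- by `2^13` outright.
  have hmain : 32 * thetaOdd * (1 + 69 * (thetaOdd * expandFour thetaNegInv) ^ 4
      + 356 * (thetaOdd * expandFour thetaNegInv) ^ 8
      + 544 * (thetaOdd * expandFour thetaNegInv) ^ 12
      + 256 * (thetaOdd * expandFour thetaNegInv) ^ 16) =
      ((32 : ℕ) * thetaOdd + (8192 : ℕ) * (69 * b' * expandFour (expandFour (theta X)) *
        expandFour b' * (expandFour (expandFour (theta X)) ^ 2 + expandFour thetaOdd ^ 2) * m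
        + 712 * b' ^ 9 * expandFour thetaNegInv ^ 8
        + 17408 * b' ^ 13 * expandFour thetaNegInv ^ 12
        + 131072 * b' ^ 17 * expandFour thetaNegInv ^ 16))
      + b' * expandFour b' * (70656 * expandFour (expandFour (theta X)) *
        (expandFour (expandFour (theta X)) ^ 2 + expandFour thetaOdd ^ 2)) := by
    have h1 : 69 * 32 * thetaOdd * (thetaOdd * expandFour thetaNegInv) ^ 4 =
        69 * 64 * b' * (16 * expandFour (expandFour (theta X)) * expandFour b' *
      (expandFour (expandFour (theta X)) ^ 2 + expandFour thetaOdd ^ 2)) * (1 + 8 * m) := by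
      rw [mul_pow, hb4, hm, hb']
      ring
    have h2 : ∀ t : ℤ⟦X⟧, 32 * thetaOdd * (1 + 356 * (thetaOdd * t) ^ 8
        + 544 * (thetaOdd * t) ^ 12 + 256 * (thetaOdd * t) ^ 16) = 32 * thetaOdd +
        8192 * (712 * b' ^ 9 * t ^ 8 + 17408 * b' ^ 13 * t ^ 12 + 131072 * b' ^ 17 * t ^ 16) := by
      intro t
      rw [hb']
      ring
    push_cast
    linear_combination h1 + h2 (expandFour thetaNegInv)
  rw [hmain]
  rw [show ∀ A B C D E : ℤ⟦X⟧, A + B + C + D + E = A + C + D + E + B by intros; ring,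
    coeff_add_supported _ _ _ _ hN, map_add, coeff_natCast_mul, coeff_natCast_mul,
    coeff_thetaOdd_of_not_isSquare hsq]
  · norm_num
  · refine mul_mem (mul_mem (ofNat_mem _ 4) ham) (sub_mem (mul_mem ?_ (pow_mem hIm _)) (one_mem _))
    exact add_mem (add_mem (add_mem (add_mem (pow_mem ham _)
      (mul_mem (mul_mem (ofNat_mem _ 276) (pow_mem ham _)) hbm))
      (mul_mem (mul_mem (ofNat_mem _ 1246) (pow_mem ham _)) (pow_mem hbm _)))
      (mul_mem (mul_mem (ofNat_mem _ 516) (pow_mem ham _)) (pow_mem hbm _)))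
      (mul_mem (ofNat_mem _ 9) (pow_mem hbm _))
  · refine (hb.pow 2).mul_mem (mul_mem (mul_mem (mul_mem (ofNat_mem _ 4) (pow_mem ham _)) ?_)
      (pow_mem hIm _))
    exact add_mem (add_mem (add_mem (mul_mem (ofNat_mem _ 40) (pow_mem ham _))
      (mul_mem (mul_mem (ofNat_mem _ 808) (pow_mem ham _)) hbm))
      (mul_mem (mul_mem (ofNat_mem _ 1080) (pow_mem ham _)) (pow_mem hbm _)))
      (mul_mem (ofNat_mem _ 120) (pow_mem hbm _))
  · refine (hb.pow 3).mul_mem (mul_mem (mul_mem (mul_mem (ofNat_mem _ 4) (pow_mem ham _)) ?_)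
      (pow_mem hIm _))
    exact add_mem (add_mem (add_mem (mul_mem (ofNat_mem _ 120) (pow_mem ham _))
      (mul_mem (mul_mem (ofNat_mem _ 1080) (pow_mem ham _)) hbm))
      (mul_mem (mul_mem (ofNat_mem _ 808) (pow_mem ham _)) (pow_mem hbm _)))
      (mul_mem (ofNat_mem _ 40) (pow_mem hbm _))
  · exact (hs'.mul hd').mul_mem (mul_mem (mul_mem (ofNat_mem _ 70656) hc)
      (add_mem (pow_mem hc 2) hd2))

/-- Since `h = 64(b' + 2w)`, modulo `2^13` the term `φ h^2` is `2^12 b'^2`, supported in class 2 mod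
8, and `h^3` vanishes. Only the multiple of `φ h` remains. -/
lemma pow_dvd_coeff_of_mem_hauptModule {f : ℤ⟦X⟧} (hf : f ∈ hauptModule) {N : ℕ}
    (hN : N % 8 = 1) (hsq : ¬ IsSquare N) : (2 : ℤ) ^ 13 ∣ coeff N f := by
  obtain ⟨p, rfl⟩ := mem_hauptModule.1 hf
  obtain ⟨b, hb, hs⟩ := exists_thetaOdd_eq
  obtain ⟨k, hk⟩ := exists_thetaNegInv_eq
  obtain ⟨u, hu⟩ := exists_theta_eq
  obtain ⟨w, hw⟩ : ∃ w, haupt = 64 * (b + 2 * w) := by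
    refine ⟨b * k + 3 * (b * thetaNegInv) ^ 2 + 8 * (b * thetaNegInv) ^ 3
      + 8 * (b * thetaNegInv) ^ 4, ?_⟩
    rw [haupt, ratioSub, hb]
    linear_combination 64 * b * hk
  set c₀ := p.coeff 0
  set c₁ := p.divX.coeff 0
  set g := Polynomial.aeval haupt p.divX.divX
  have hp : Polynomial.aeval haupt p = (c₀ : ℤ⟦X⟧) + haupt * (c₁ + haupt * g) := by
    conv_lhs => rw [← Polynomial.divX_mul_X_add p, ← Polynomial.divX_mul_X_add p.divX]
    simp only [map_add, map_mul, Polynomial.aeval_X, Polynomial.aeval_C]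
    simp only [eq_intCast]
    ring
  have h2 : theta X * haupt * Polynomial.aeval haupt p = c₀ • (theta X * haupt)
      + (4096 : ℕ) * (b ^ 2 * c₁)
      + (8192 : ℕ) * (c₁ * (u * (b + 2 * w) ^ 2 + 2 * b * w + 2 * w ^ 2)
        + 32 * theta X * (b + 2 * w) ^ 3 * g) := by
    rw [hp, zsmul_eq_mul]
    have h3 : theta X * haupt ^ 2 = 4096 * b ^ 2 + 8192 * (u * (b + 2 * w) ^ 2 + 2 * b * w
        + 2 * w ^ 2) := by
      rw [hu, hw]; ring
    have h4 : haupt ^ 3 = 262144 * (b + 2 * w) ^ 3 := by rw [hw]; ring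
    push_cast
    linear_combination c₁ * h3 + theta X * g * h4
  have h5 : coeff N (b ^ 2 * (c₁ : ℤ⟦X⟧)) = 0 := by
    refine ((hs.pow 2).mul (SupportedMod.intCast c₁)).coeff_eq_zero fun h => ?_
    unfold Nat.ModEq at h
    omega
  rw [h2, map_add, map_add, coeff_natCast_mul, coeff_natCast_mul, h5, mul_zero, add_zero, map_zsmul,
    smul_eq_mul]
  exact dvd_add ((pow_dvd_coeff_theta_mul_haupt hN hsq).mul_left _)
    (Dvd.dvd.mul_right (by norm_num) _)

/-! ### Conclusion for `v0` and the two families of indices. -/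

/-- Divisibility of `v0 (4^{α+1} N)` for a non-square `N ≡ 1 (mod 8)`. -/
theorem pow_dvd_v0 (α : ℕ) {N : ℕ} (hN : N % 8 = 1) (hsq : ¬ IsSquare N) :
    (2 : ℤ) ^ (3 * α + 9) ∣ v0 (4 ^ (α + 1) * N) := by
  -- The coefficients of `F` are `2 v0`, hence one extra power of 2.
  have h2 : (2 : ℤ) ^ (3 * α + 10) ∣ 2 * v0 (4 ^ (α + 1) * N) := by
    rw [pow_succ' 4 α, mul_assoc, ← coeff_quarticSection
      (mul_ne_zero (pow_ne_zero _ four_ne_zero) (by rintro rfl; simp at hN))]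
    rcases α with _ | α
    · simpa using pow_dvd_coeff_quarticSection hN hsq
    · obtain ⟨m, hm, h⟩ := sect_four_iterate_quarticSection α
      rw [← coeff_sect_four_iterate, h, map_add, coeff_theta_of_not_isSquare hsq, zero_add,
        show (8 ^ α * m : ℤ⟦X⟧) = ((8 ^ α : ℕ) : ℤ⟦X⟧) * m by push_cast; ring, coeff_natCast_mul,
        show 3 * (α + 1) + 10 = 3 * α + 13 by ring, pow_add, pow_mul]
      exact mul_dvd_mul (by norm_num) (pow_dvd_coeff_of_mem_hauptModule hm hN hsq)
  rw [show 3 * α + 10 = (3 * α + 9) + 1 by ring, pow_succ'] at h2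
  exact (mul_dvd_mul_iff_left two_ne_zero).1 h2

lemma pow_dvd_of_sq_eq {p k u m : ℕ} (hp : 0 < p) (h : p ^ (2 * k) * u = m * m) :
    ∃ m', u = m' * m' := by
  have h1 : p ^ k ∣ m := by
    rw [← Nat.pow_dvd_pow_iff two_ne_zero, ← pow_mul, mul_comm k, sq m, ← h]
    exact dvd_mul_right _ _
  obtain ⟨m', rfl⟩ := h1
  refine ⟨m', Nat.eq_of_mul_eq_mul_left (pow_pos hp (2 * k)) (h.trans ?_)⟩
  ring

lemma odd_pow_mod_eight {p : ℕ} (hp : Odd p) (k : ℕ) : p ^ (2 * k) % 8 = 1 := by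
  obtain ⟨l, rfl⟩ := hp
  obtain ⟨u, hu⟩ := Nat.even_mul_succ_self l
  have h : (2 * l + 1) ^ 2 % 8 = 1 := by
    have : (2 * l + 1) ^ 2 = 8 * u + 1 := by nlinarith
    omega
  rw [pow_mul, Nat.pow_mod, h, one_pow, Nat.one_mod]

theorem mainTheorem5 (p : ℕ) [Fact p.Prime] (hp : Odd p) (n α β : ℕ) :
    (∀ i : ℕ, 1 ≤ i → i ≤ p - 1 →
      v0 (2 ^ (2 * α + 2) * p ^ (2 * β + 1) * (8 * p * n + 8 * i + p)) ≡ 0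
        [ZMOD 2 ^ (3 * α + 9)]) ∧
    (∀ j : ℕ, j ≤ p - 1 → legendreSym p (8 * (j : ℤ) + 1) = -1 →
      v0 (2 ^ (2 * α + 2) * p ^ (2 * β) * (8 * p * n + 8 * j + 1)) ≡ 0
        [ZMOD 2 ^ (3 * α + 9)]) := by
  have hpp : p.Prime := Fact.out
  have h4 : 2 ^ (2 * α + 2) = 4 ^ (α + 1) := by
    rw [show 2 * α + 2 = 2 * (α + 1) by ring, pow_mul]; norm_num
  refine ⟨fun i hi hip => ?_, fun j hj hleg => ?_⟩
  · rw [Int.modEq_zero_iff_dvd, h4, mul_assoc]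
    refine pow_dvd_v0 α ?_ ?_
    · rw [show p ^ (2 * β + 1) * (8 * p * n + 8 * i + p) =
        8 * (p ^ (2 * β + 1) * (p * n + i)) + p ^ (2 * (β + 1)) by ring, Nat.mul_add_mod,
        odd_pow_mod_eight hp]
    · rintro ⟨m, hm⟩
      rw [pow_succ, mul_assoc] at hm
      obtain ⟨m', hm'⟩ := pow_dvd_of_sq_eq hpp.pos hm
      have h1 : p ∣ m' := by
        have : p ∣ m' * m' := ⟨_, hm'.symm⟩
        rcases hpp.dvd_mul.1 this with h | h <;> exact h
      obtain ⟨l, rfl⟩ := h1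
      have h2 : 8 * p * n + 8 * i + p = p * (l * l) :=
        Nat.eq_of_mul_eq_mul_left hpp.pos (hm'.trans (by ring))
      -- A square would force a further factor `p`, hence `p ∣ 8i`, impossible for odd `p` and `0 <
      -- i < p`.
      have h3 : p ∣ 8 * i := by
        have h5 : p ∣ 8 * p * n + 8 * i + p := ⟨_, h2⟩
        have h6 := (Nat.dvd_add_left (dvd_refl p)).1 h5
        exact (Nat.dvd_add_right ⟨8 * n, by ring⟩).1 h6
      have h5 : Nat.Coprime p 8 := (Nat.Coprime.pow_right 3 (Nat.coprime_two_right.2 hp))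
      have h6 := Nat.le_of_dvd hi (h5.dvd_of_dvd_mul_left h3)
      have := hpp.pos
      omega
  · rw [Int.modEq_zero_iff_dvd, h4, mul_assoc]
    refine pow_dvd_v0 α ?_ ?_
    · have h := odd_pow_mod_eight hp β
      rw [show p ^ (2 * β) * (8 * p * n + 8 * j + 1) =
        8 * (p ^ (2 * β) * (p * n + j)) + p ^ (2 * β) by ring, Nat.mul_add_mod, h]
    · rintro ⟨m, hm⟩
      obtain ⟨m', hm'⟩ := pow_dvd_of_sq_eq hpp.pos hm
      rw [legendreSym.eq_neg_one_iff] at hleg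
      refine hleg ⟨(m' : ZMod p), ?_⟩
      have h := congrArg (Nat.cast : ℕ → ZMod p) hm'
      push_cast at h ⊢
      rw [← h]
      simp
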